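/- Let $p$ be a prime. For an element $r$ of a free group $F$ let $\nu_p(r)$ be the largest $k$ such that $r=s^{p^k}$ for some $s\in F$ (and $p^{-\nu_p(1)}=0$). The $p$-deficiency of a presentation $\langle X|R\rangle$ with $X$ finite is $|X|-1-\sum_{r\in R}p^{-\nu_p(r)}$ ($-\infty$ if the series diverges), and $\mathrm{def}_p(\Gamma)$ is the supremum of the $p$-deficiencies of all presentations of the group $\Gamma$ with finite generating set. Write $d(G)$ for the minimal number of generators of $G$. For a finitely generated residually finite group $\Gamma$, the rank gradient $\mathrm{rg}(\Gamma)$ is the infimum of $\liminf_i d(N_i)/(\Gamma:N_i)$ over all sequences $(N_i)$ of finite index normal subgroups of $\Gamma$ with $\bigcap_i N_i=\{1\}$. Let $s_k^{\triangleleft\triangleleft}(\Gamma)$ be the number of subnormal subgroups of index $k$ of a group $\Gamma$, and, for a pro-$p$ group $\Gamma$, let $s_k(\Gamma)$ be the number of its open subgroups of index $k$. A $p$-group is a (possibly infinite) group in which the order of every element is a power of $p$. 1. If $\Gamma$ is a finitely generated residually finite $p$-group, then $\mathrm{def}_p(\Gamma)\le\mathrm{rg}(\Gamma)$. 2. Let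 $\Gamma$ be a group with $\mathrm{def}_p(\Gamma)\ge 0$. Then $\mathrm{def}_p(\Gamma)<\infty$, and for every $\epsilon>0$ there is a constant $c>0$ such that for all $n\ge 0$ $$s_{p^n}^{\triangleleft\triangleleft}(\Gamma)\ \ge\ c\,p^{(\mathrm{def}_p(\Gamma)-\epsilon)\frac{p^{n}}{p-1}}.$$ 3. For every $d\ge 2$ and $\epsilon>0$ there exists a $p$-group $\Gamma$ with $d(\Gamma)=d$ and $\mathrm{def}_p(\Gamma)\ge d-1-\epsilon$. 4. For every $d\ge 2$ and $\epsilon>0$ there exists a pro-$p$ group $\Gamma$ of topological rank $d$, containing a dense (abstract) subgroup which is a $p$-group and whose minimal number of generators is $d$, and a constant $c>0$ such that $s_{p^n}(\Gamma)\ge c\,s_{p^n}(\widehat{F_d})^{1-\epsilon}$ for all $n\ge 0$, where $\widehat{F_d}$ is the free pro-$p$ group on $d$ generators. -/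

import Mathlib

open scoped ENNReal

noncomputable section

/-- The `p`-order `ν_p(r)` of an element of a group `F` (in applications a free group): the
largest `k` such that `r = s ^ (p ^ k)` for some `s ∈ F`, and `⊤` if there is no largest one
(in a free group this happens only for `r = 1`). -/
def pOrder (p : ℕ) {F : Type*} [Group F] (r : F) : ℕ∞ :=
  ⨆ (k : ℕ) (_ : ∃ s : F, s ^ p ^ k = r), (k : ℕ∞)

/-- The number `p ^ (-ν)`, with `p ^ (-∞) = 0`. -/
def pNegPow (p : ℕ) : ℕ∞ → ℝ≥0∞
  | ⊤ => 0
  | (k : ℕ) => ((p : ℝ≥0∞) ^ k)⁻¹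

/-- The `p`-deficiency `|X| - 1 - ∑_{r ∈ R} p ^ (-ν_p(r))` of a presentation `⟨X | R⟩`, where `X`
has `m` elements and `R` may be infinite; it is `-∞` if the series diverges. -/
def presentationPDeficiency (p m : ℕ) (R : Set (FreeGroup (Fin m))) : EReal :=
  (m : EReal) - 1 - ((∑' r : R, pNegPow p (pOrder p (r : FreeGroup (Fin m))) : ℝ≥0∞) : EReal)

/-- The `p`-deficiency of a group: the supremum of the `p`-deficiencies of its presentations with
finitely many generators. -/
def pDeficiency (p : ℕ) (Γ : Type*) [Group Γ] : EReal :=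
  ⨆ (m : ℕ) (R : Set (FreeGroup (Fin m))) (_ : Nonempty (PresentedGroup R ≃* Γ)),
    presentationPDeficiency p m R

/-- A sequence of finite index normal subgroups with trivial intersection. -/
structure NormalSequence (Γ : Type*) [Group Γ] where
  /-- the subgroups -/
  N : ℕ → Subgroup Γ
  normal : ∀ i, (N i).Normal
  finiteIndex : ∀ i, (N i).FiniteIndex
  iInf_eq_bot : ⨅ i, N i = ⊥

instance NormalSequence.instFiniteIndex {Γ : Type*} [Group Γ] (S : NormalSequence Γ) (i : ℕ) :
    (S.N i).FiniteIndex := S.finiteIndex i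

/-- The rank gradient `liminf d(N_i) / (Γ : N_i)` of a finitely generated group along a
sequence. -/
def rankGradientAlong {Γ : Type*} [Group Γ] [Group.FG Γ] (S : NormalSequence Γ) : ℝ≥0∞ :=
  Filter.liminf (fun i => (Group.rank (S.N i) : ℝ≥0∞) / ((S.N i).index : ℝ≥0∞)) Filter.atTop

/-- The rank gradient of a finitely generated group. -/
def rankGradient (Γ : Type*) [Group Γ] [Group.FG Γ] : ℝ≥0∞ :=
  ⨅ S : NormalSequence Γ, rankGradientAlong S

/-- The number of subnormal subgroups of index `k`. -/
def subnormalCount (Γ : Type*) [Group Γ] (k : ℕ) : ℕ :=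
  {H : Subgroup Γ | H.IsSubnormal ∧ H.index = k}.ncard

/-- The number of open subgroups of index `k` of a topological group. -/
def openSubgroupCount (G : Type*) [Group G] [TopologicalSpace G] (k : ℕ) : ℕ :=
  {H : Subgroup G | IsOpen (H : Set G) ∧ H.index = k}.ncard

/-- Pro-`p` groups: profinite groups all of whose open normal subgroups have `p`-power index. -/
structure IsProP (p : ℕ) (G : Type*) [Group G] [TopologicalSpace G] : Prop where
  isTopologicalGroup : IsTopologicalGroup G
  compactSpace : CompactSpace G
  t2Space : T2Space G
  totallyDisconnectedSpace : TotallyDisconnectedSpace G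
  index_eq : ∀ U : Subgroup G, U.Normal → IsOpen (U : Set G) → ∃ k : ℕ, U.index = p ^ k

/-- The topological rank: the minimal number of elements generating a dense subgroup. -/
def topologicalRank (G : Type*) [Group G] [TopologicalSpace G] : ℕ∞ :=
  ⨅ (S : Finset G) (_ : Dense (Subgroup.closure (S : Set G) : Set G)), (S.card : ℕ∞)

/-- The normal subgroups of `p`-power index of a group. -/
structure PPowerIndexNormal (p : ℕ) (G : Type*) [Group G] where
  /-- the subgroup -/
  N : Subgroup G
  normal : N.Normal
  index_eq : ∃ k : ℕ, N.index = p ^ k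

instance PPowerIndexNormal.instNormal {p : ℕ} {G : Type*} [Group G] (M : PPowerIndexNormal p G) :
    M.N.Normal := M.normal

/-- The quotient by a normal subgroup of `p`-power index, as a discrete group. -/
def PPowerIndexNormal.Quot {p : ℕ} {G : Type*} [Group G] (M : PPowerIndexNormal p G) : Type _ :=
  G ⧸ M.N

instance {p : ℕ} {G : Type*} [Group G] (M : PPowerIndexNormal p G) : Group M.Quot :=
  inferInstanceAs (Group (G ⧸ M.N))

instance {p : ℕ} {G : Type*} [Group G] (M : PPowerIndexNormal p G) : TopologicalSpace M.Quot := ⊥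

instance {p : ℕ} {G : Type*} [Group G] (M : PPowerIndexNormal p G) : DiscreteTopology M.Quot :=
  ⟨rfl⟩

/-- The transition map `G ⧸ M → G ⧸ M'` for `M ≤ M'`. -/
def PPowerIndexNormal.transition {p : ℕ} {G : Type*} [Group G] (M M' : PPowerIndexNormal p G)
    (h : M.N ≤ M'.N) : M.Quot →* M'.Quot :=
  QuotientGroup.map M.N M'.N (MonoidHom.id G) h

/-- The pro-`p` completion of a group `G`: the inverse limit of the quotients of `G` by its normal
subgroups of `p`-power index, as a subgroup of their product, with the subspace topology. -/
def proPCompletion (p : ℕ) (G : Type*) [Group G] :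
    Subgroup (∀ M : PPowerIndexNormal p G, M.Quot) where
  carrier := {x | ∀ (M M' : PPowerIndexNormal p G) (h : M.N ≤ M'.N), M.transition M' h (x M) = x M'}
  one_mem' := fun M M' h => map_one (M.transition M' h)
  mul_mem' := fun {x y} hx hy M M' h => by
    rw [Pi.mul_apply, Pi.mul_apply, map_mul, hx M M' h, hy M M' h]
  inv_mem' := fun {x} hx M M' h => by
    rw [Pi.inv_apply, Pi.inv_apply, map_inv, hx M M' h]

/-- The free pro-`p` group on `d` generators: the pro-`p` completion of the free group. -/
abbrev FreeProP (p d : ℕ) : Type :=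
  proPCompletion p (FreeGroup (Fin d))

end

/-!
Everything follows from one inequality. Let `F → Γ` be a presentation with `m` generators and
relators `R`, let `H` be a subgroup of `Γ` of finite index `n`, and `X = Γ ⧸ H`. By Shapiro's lemma
(`shapiroEquiv`) the homomorphisms `H → ZMod p` are, up to coboundaries, the `1`-cocycles of `Γ`
with values in the functions `X → ZMod p`; counting gives `|Z¹(Γ)| * p = |Hom(H, ZMod p)| * p ^ n`
(`card_cocycles_mul`). The cocycles of `Γ` are the cocycles of `F` that vanish on `R`
(`card_cocycles_quotient`), and those of `F` form a space of dimension `m * n`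
(`freeCocyclesEquiv`). A relator `r = s ^ q`, with `q` a power of `p`, acts trivially on `X`, so
that the cycles of `s` have lengths dividing `q`. The value of a cocycle at `r` is a sum over the
cycles of `s`, which vanishes on all cycles shorter than `q` and is constant on the others
(`cocycle_pow_mem_cycleFunctions`). There are at most `n / q` cycles of length `q`, so `r` imposes
at most `n * p ^ (-ν_p(r))` conditions. Hence `|Hom(H, ZMod p)| ≥ p ^ (1 + n * def_p(Γ))`
(`pDeficiency_le`, `rpow_le_card_hom_of_pDeficiency`). No freeness of subgroups of free groups is
needed, and for `Γ = F` the same count gives equality (`card_hom_subgroup_freeGroup`).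

The rank gradient is bounded below because `|Hom(H, ZMod p)| ≤ p ^ d(H)`. For the growth of
subnormal subgroups, the kernel `K` of a nontrivial homomorphism `φ : H → ZMod p` is subnormal of
index `p * n` if `H` is subnormal of index `n`, and the pair `(H, φ)` is determined by `K` and the
coset of `K` on which `φ` is `1`, so that `K` occurs for at most `p * n` pairs
(`subnormalCount_mul_le`); multiplying up gives `subnormalCount_ge`. A group of `p`-deficiency close
to `d - 1` in which all elements have `p`-power order is obtained from the free group of rank `d` by
killing a high `p`-power of each element (`powerRelators`).

Its pro-`p` completion serves for the last assertion. Open subgroups of a pro-`p` completion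
correspond to the subgroups containing a normal subgroup of `p`-power index
(`openSubgroupCount_proPCompletion`). In a `p`-group these include all subnormal subgroups of
`p`-power index; in a free group they are kernels of homomorphisms to `ZMod p` of subgroups of the
same kind (`exists_ambientKer_eq`), and the number of these homomorphisms is known exactly, so that
the growth is bounded above (`ncard_isPOpen_le`).
-/

/-! ### Cocycles with values in functions on a permutation representation -/

/-- The `1`-cocycles of `G` with values in the functions `X → ZMod p`, where `G` acts on `X` through
`ρ`. The convention `D (g * h) x = D g (ρ h x) + D h x` makes `D` a homomorphism from the action
groupoid of `X` to `ZMod p`. -/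
def cocycles (p : ℕ) {G X : Type*} [Group G] (ρ : G →* Equiv.Perm X) :
    Submodule (ZMod p) (G → X → ZMod p) where
  carrier := {D | ∀ g h x, D (g * h) x = D g (ρ h x) + D h x}
  zero_mem' := by simp
  add_mem' := by
    intro D E hD hE g h x
    simp only [Pi.add_apply, hD g h x, hE g h x]
    ring
  smul_mem' := by
    intro a D hD g h x
    simp only [Pi.smul_apply, hD g h x, smul_add]

section Cocycles

variable {p : ℕ} {G X : Type*} [Group G] {ρ : G →* Equiv.Perm X} {D : G → X → ZMod p}

lemma cocycles.map_mul (hD : D ∈ cocycles p ρ) (g h : G) (x : X) :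
    D (g * h) x = D g (ρ h x) + D h x := hD g h x

lemma cocycles.map_one (hD : D ∈ cocycles p ρ) (x : X) : D 1 x = 0 := by
  have h := hD 1 1 x
  simpa using h

lemma cocycles.map_inv (hD : D ∈ cocycles p ρ) (g : G) (x : X) :
    D g⁻¹ x = - D g (ρ g⁻¹ x) := by
  have h := hD g g⁻¹ x
  rw [mul_inv_cancel, cocycles.map_one hD] at h
  exact eq_neg_of_add_eq_zero_right h.symm

lemma cocycles.map_pow (hD : D ∈ cocycles p ρ) (g : G) (q : ℕ) (x : X) :
    D (g ^ q) x = ∑ i ∈ Finset.range q, D g ((ρ g)^[i] x) := by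
  induction q with
  | zero => simpa using cocycles.map_one hD x
  | succ q ih =>
    rw [pow_succ', cocycles.map_mul hD, ih, Finset.sum_range_succ, add_comm, _root_.map_pow]
    rw [Equiv.Perm.iterate_eq_pow]

end Cocycles

/-- The skew product of a permutation `σ` of `X` with a function `f : X → ZMod p`: the permutation
`(x, a) ↦ (σ x, a + f x)` of `X × ZMod p`. -/
def skewProduct {p : ℕ} {X : Type*} (σ : Equiv.Perm X) (f : X → ZMod p) :
    Equiv.Perm (X × ZMod p) where
  toFun y := (σ y.1, y.2 + f y.1)
  invFun y := (σ.symm y.1, y.2 - f (σ.symm y.1))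
  left_inv y := by simp
  right_inv y := by simp

lemma skewProduct_inv_apply {p : ℕ} {X : Type*} (σ : Equiv.Perm X) (f : X → ZMod p)
    (y : X × ZMod p) : (skewProduct σ f)⁻¹ y = (σ⁻¹ y.1, y.2 - f (σ⁻¹ y.1)) := rfl

/-- A cocycle of a free group is determined by its values on the generators, and these can be
prescribed. -/
lemma exists_cocycle_of_freeGroup {p : ℕ} {α X : Type*} (ρ : FreeGroup α →* Equiv.Perm X)
    (f : α → X → ZMod p) : ∃ D ∈ cocycles p ρ, ∀ a, D (FreeGroup.of a) = f a := by
  let τ : FreeGroup α →* Equiv.Perm (X × ZMod p) :=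
    FreeGroup.lift fun a => skewProduct (ρ (FreeGroup.of a)) (f a)
  -- The action through `τ` lifts the one through `ρ` and commutes with translations.
  have key : ∀ g, ∀ x a, τ g (x, a) = (ρ g x, a + (τ g (x, 0)).2) := by
    intro g
    induction g using FreeGroup.induction_on with
    | C1 => simp
    | of b => intro x a; simp [τ, skewProduct]
    | inv_of b _ =>
      intro x a
      simp [τ, skewProduct_inv_apply, sub_eq_add_neg]
    | mul g h hg hh =>
      intro x a
      simp only [map_mul, Equiv.Perm.mul_apply]
      rw [hh x a, hg, hh x 0, hg _ (0 + _)]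
      simp [add_assoc]
  refine ⟨fun g x => (τ g (x, 0)).2, ?_, ?_⟩
  · intro g h x
    simp only [map_mul, Equiv.Perm.mul_apply]
    rw [key h, key g]
    simp [add_comm]
  · intro b
    funext x
    simp [τ, skewProduct]

lemma cocycle_freeGroup_ext {p : ℕ} {α X : Type*} {ρ : FreeGroup α →* Equiv.Perm X}
    {D E : FreeGroup α → X → ZMod p} (hD : D ∈ cocycles p ρ) (hE : E ∈ cocycles p ρ)
    (h : ∀ a, D (FreeGroup.of a) = E (FreeGroup.of a)) : D = E := by
  funext g
  induction g using FreeGroup.induction_on with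
  | C1 => funext x; rw [cocycles.map_one hD, cocycles.map_one hE]
  | of a => exact h a
  | inv_of a _ => funext x; rw [cocycles.map_inv hD, cocycles.map_inv hE, h a]
  | mul g k hg hk => funext x; rw [cocycles.map_mul hD, cocycles.map_mul hE, hg, hk]

/-- The cocycles of a free group are the functions on generators. -/
noncomputable def freeCocyclesEquiv (p : ℕ) {α X : Type*} (ρ : FreeGroup α →* Equiv.Perm X) :
    cocycles p ρ ≃ₗ[ZMod p] (α → X → ZMod p) :=
  LinearEquiv.ofBijective
    { toFun := fun (D : cocycles p ρ) a => D.1 (FreeGroup.of a)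
      map_add' := fun _ _ => rfl
      map_smul' := fun _ _ => rfl }
    ⟨fun D E h => Subtype.ext (cocycle_freeGroup_ext D.2 E.2 fun a => congrFun h a), fun f => by
      obtain ⟨D, hD, h⟩ := exists_cocycle_of_freeGroup ρ f
      exact ⟨⟨D, hD⟩, funext h⟩⟩

/-! ### Shapiro's lemma in degree one -/

open scoped Classical in
/-- Coset representatives of `H`, with the representative `1` for `H` itself. -/
noncomputable def cosetRep {G : Type*} [Group G] (H : Subgroup G) (x : G ⧸ H) : G :=
  if x = ((1 : G) : G ⧸ H) then 1 else x.out

lemma cosetRep_one {G : Type*} [Group G] (H : Subgroup G) :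
    cosetRep H ((1 : G) : G ⧸ H) = 1 := by simp [cosetRep]

lemma mk_cosetRep {G : Type*} [Group G] (H : Subgroup G) (x : G ⧸ H) :
    ((cosetRep H x : G) : G ⧸ H) = x := by
  unfold cosetRep
  split_ifs with h
  · exact h.symm
  · exact x.out_eq'

lemma cosetRep_mul_mem {G : Type*} [Group G] (H : Subgroup G) (g : G) (x : G ⧸ H) :
    (cosetRep H (g • x))⁻¹ * (g * cosetRep H x) ∈ H := by
  rw [← QuotientGroup.eq, mk_cosetRep, ← smul_eq_mul, ← MulAction.Quotient.smul_coe, mk_cosetRep]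

/-- Shapiro's lemma on the level of cocycles: a cocycle of `G` with values in the functions on
`G ⧸ H`, together with a constant, amounts to a homomorphism `H → ZMod p` together with a function
on `G ⧸ H`, whose coboundary is the rest of the cocycle. -/
noncomputable def shapiroEquiv (p : ℕ) {G : Type*} [Group G] (H : Subgroup G) :
    cocycles p (MulAction.toPermHom G (G ⧸ H)) × ZMod p ≃
      (H →* Multiplicative (ZMod p)) × (G ⧸ H → ZMod p) where
  toFun y :=
    ({ toFun := fun h => Multiplicative.ofAdd (y.1.1 h ((1 : G) : G ⧸ H))
       map_one' := by
        rw [H.coe_one, cocycles.map_one y.1.2]; rfl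
       map_mul' := fun h k => by
        have e : MulAction.toPermHom G (G ⧸ H) k ((1 : G) : G ⧸ H) = ((1 : G) : G ⧸ H) := by
          rw [MulAction.toPermHom_apply, MulAction.toPerm_apply, MulAction.Quotient.smul_coe,
            smul_eq_mul, mul_one]
          exact (QuotientGroup.eq.2 (by simp)).symm
        rw [H.coe_mul, cocycles.map_mul y.1.2, e]; rfl },
      fun x => y.1.1 (cosetRep H x) ((1 : G) : G ⧸ H) + y.2)
  invFun z :=
    (⟨fun g x => (z.1 ⟨_, cosetRep_mul_mem H g x⟩).toAdd + z.2 (g • x) - z.2 x, fun g h x => by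
        have e : (⟨_, cosetRep_mul_mem H (g * h) x⟩ : H) =
            ⟨_, cosetRep_mul_mem H g (h • x)⟩ * ⟨_, cosetRep_mul_mem H h x⟩ := by
          ext
          simp [mul_smul, mul_assoc]
        have e2 := congrArg (fun u => (z.1 u).toAdd) e
        simp only [map_mul, toAdd_mul] at e2
        have e3 := congrArg z.2 (mul_smul g h x)
        simp only [MulAction.toPermHom_apply, MulAction.toPerm_apply]
        linear_combination e2 + e3⟩,
      z.2 ((1 : G) : G ⧸ H))
  left_inv := by
    rintro ⟨⟨D, hD⟩, a⟩
    have hm := fun g h x => cocycles.map_mul hD g h x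
    simp only [MulAction.toPermHom_apply, MulAction.toPerm_apply] at hm
    refine Prod.ext (Subtype.ext ?_) ?_
    · funext g x
      have h1 := hm g (cosetRep H x) ((1 : G) : G ⧸ H)
      have h2 := hm (cosetRep H (g • x)) ((cosetRep H (g • x))⁻¹ * (g * cosetRep H x))
        ((1 : G) : G ⧸ H)
      have e1 : ∀ x : G ⧸ H, cosetRep H x • ((1 : G) : G ⧸ H) = x := fun x => by
        rw [MulAction.Quotient.smul_coe, smul_eq_mul, mul_one, mk_cosetRep]
      have e2 : ((cosetRep H (g • x))⁻¹ * (g * cosetRep H x)) • ((1 : G) : G ⧸ H) =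
          ((1 : G) : G ⧸ H) := by
        rw [mul_smul, mul_smul, e1, inv_smul_eq_iff, e1]
      rw [e1] at h1
      rw [mul_inv_cancel_left, e2, h1] at h2
      simp only [MonoidHom.coe_mk, OneHom.coe_mk, toAdd_ofAdd]
      linear_combination -h2
    · simp only [cosetRep_one, cocycles.map_one hD, zero_add]
  right_inv := by
    rintro ⟨φ, c⟩
    refine Prod.ext (MonoidHom.ext fun h => ?_) (funext fun x => ?_)
    · have e : (h : G) • ((1 : G) : G ⧸ H) = ((1 : G) : G ⧸ H) := by
        rw [MulAction.Quotient.smul_coe, smul_eq_mul, mul_one]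
        exact (QuotientGroup.eq.2 (by simp)).symm
      have e2 : (⟨_, cosetRep_mul_mem H h ((1 : G) : G ⧸ H)⟩ : H) = h := by
        ext
        simp [e, cosetRep_one]
      simp only [MonoidHom.coe_mk, OneHom.coe_mk, e2]
      rw [e]
      simp
    · have e : cosetRep H x • ((1 : G) : G ⧸ H) = x := by
        rw [MulAction.Quotient.smul_coe, smul_eq_mul, mul_one, mk_cosetRep]
      have e2 : (⟨_, cosetRep_mul_mem H (cosetRep H x) ((1 : G) : G ⧸ H)⟩ : H) = 1 := by
        ext
        simp [e, cosetRep_one]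
      simp only [e2]
      rw [e]
      simp

lemma card_cocycles_mul {p : ℕ} [Fact p.Prime] {G : Type*} [Group G] (H : Subgroup G)
    [H.FiniteIndex] :
    Nat.card (cocycles p (MulAction.toPermHom G (G ⧸ H))) * p =
      Nat.card (H →* Multiplicative (ZMod p)) * p ^ H.index := by
  have h := Nat.card_congr (shapiroEquiv p H)
  rw [Nat.card_prod, Nat.card_prod, Nat.card_zmod, Nat.card_fun, Nat.card_zmod] at h
  exact h

/-! ### The conditions imposed by a relator -/

/-- The functions on `X` that are invariant under `σ` and supported on the cycles of length `q`. -/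
def cycleFunctions (p : ℕ) {X : Type*} (σ : Equiv.Perm X) (q : ℕ) :
    Submodule (ZMod p) (X → ZMod p) where
  carrier := {w | (∀ x, w (σ x) = w x) ∧ ∀ x, Function.minimalPeriod σ x ≠ q → w x = 0}
  zero_mem' := by simp
  add_mem' := by
    rintro v w ⟨hv, hv'⟩ ⟨hw, hw'⟩
    refine ⟨fun x => by simp [hv, hw], fun x hx => by simp [hv' x hx, hw' x hx]⟩
  smul_mem' := by
    rintro a w ⟨hw, hw'⟩
    refine ⟨fun x => by simp [hw], fun x hx => by simp [hw' x hx]⟩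

/-- There are at most `|X| / q` cycles of length `q`. -/
lemma finrank_cycleFunctions_mul_le {p : ℕ} [Fact p.Prime] {X : Type*} [Finite X]
    (σ : Equiv.Perm X) (q : ℕ) :
    Module.finrank (ZMod p) (cycleFunctions p σ q) * q ≤ Nat.card X := by
  classical
  have := Fintype.ofFinite X
  let st := Equiv.Perm.SameCycle.setoid σ
  have hout : ∀ x : X, σ.SameCycle (Quotient.mk st x).out x := fun x =>
    Quotient.exact (s := st) (Quotient.out_eq _)
  -- `T` contains one point of each cycle of length `q`.
  let T := {x : X // Function.minimalPeriod σ x = q ∧ (Quotient.mk st x).out = x}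
  have hper : ∀ x y : X, σ.SameCycle x y →
      Function.minimalPeriod σ x = Function.minimalPeriod σ y := by
    intro x y hxy
    obtain ⟨i, rfl⟩ := hxy.exists_nat_pow_eq
    rw [← Equiv.Perm.iterate_eq_pow]
    refine (Function.minimalPeriod_apply_iterate ?_ i).symm
    exact Function.Injective.mem_periodicPts σ.injective x
  have h1 : Module.finrank (ZMod p) (cycleFunctions p σ q) ≤ Nat.card T := by
    let L : cycleFunctions p σ q →ₗ[ZMod p] (T → ZMod p) :=
      (LinearMap.funLeft (ZMod p) (ZMod p) (fun t : T => t.1)).comp (cycleFunctions p σ q).subtype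
    have hL : Function.Injective L := by
      rw [← LinearMap.ker_eq_bot, LinearMap.ker_eq_bot']
      rintro ⟨w, hw, hw'⟩ h
      ext x
      by_cases hx : Function.minimalPeriod σ x = q
      · have hinv : ∀ y z, σ.SameCycle y z → w z = w y := by
          intro y z hyz
          obtain ⟨i, rfl⟩ := hyz.exists_nat_pow_eq
          induction i with
          | zero => simp
          | succ i ih => rw [pow_succ', Equiv.Perm.mul_apply, hw]; exact ih ⟨i, by simp⟩
        have hT : Function.minimalPeriod σ (Quotient.mk st x).out = q := by
          rw [hper _ _ (hout x), hx]
        have := congrFun h ⟨(Quotient.mk st x).out, hT, by rw [Quotient.out_eq]⟩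
        change w x = 0
        rw [hinv _ _ (hout x)]
        exact this
      · exact hw' x hx
    have := LinearMap.finrank_le_finrank_of_injective hL
    rwa [Module.finrank_fintype_fun_eq_card, ← Nat.card_eq_fintype_card] at this
  have h2 : Nat.card T * q ≤ Nat.card X := by
    have hinj : Function.Injective (fun y : T × Fin q => (σ : X → X)^[y.2] y.1.1) := by
      rintro ⟨⟨t, ht, ht'⟩, i⟩ ⟨⟨u, hu, hu'⟩, j⟩ h
      dsimp only at h
      have htu : σ.SameCycle t u := by
        have a : σ.SameCycle t ((σ : X → X)^[i] t) := ⟨(i : ℕ), by simp [Equiv.Perm.iterate_eq_pow]⟩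
        have b : σ.SameCycle u ((σ : X → X)^[j] u) := ⟨(j : ℕ), by simp [Equiv.Perm.iterate_eq_pow]⟩
        exact a.trans (h ▸ b.symm)
      have : t = u := by
        rw [← ht', ← hu', Quotient.sound (s := st) htu]
      subst this
      have hi : (i : ℕ) ∈ Set.Iio (Function.minimalPeriod σ t) := by rw [ht]; exact i.2
      have hj : (j : ℕ) ∈ Set.Iio (Function.minimalPeriod σ t) := by rw [ht]; exact j.2
      have := Function.iterate_injOn_Iio_minimalPeriod hi hj h
      rw [Fin.ext this]
    have := Nat.card_le_card_of_injective _ hinj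
    rwa [Nat.card_prod, Nat.card_fin] at this
  exact (Nat.mul_le_mul_right q h1).trans h2

/-- The value of a cocycle at a `q`-th power acting trivially is the sum over the `σ`-orbits with
multiplicity `q / length`, which is divisible by `p` unless the length is `q`. -/
lemma cocycle_pow_mem_cycleFunctions {p : ℕ} [Fact p.Prime] {G X : Type*} [Group G]
    {ρ : G →* Equiv.Perm X} {D : G → X → ZMod p} (hD : D ∈ cocycles p ρ) (s : G) (k : ℕ)
    (h1 : ρ (s ^ p ^ k) = 1) : D (s ^ p ^ k) ∈ cycleFunctions p (ρ s) (p ^ k) := by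
  refine ⟨fun x => ?_, fun x hx => ?_⟩
  · have a := cocycles.map_mul hD s (s ^ p ^ k) x
    have b := cocycles.map_mul hD (s ^ p ^ k) s x
    rw [← pow_succ, pow_succ', a, h1, Equiv.Perm.one_apply, add_comm] at b
    exact (add_right_cancel b).symm
  · have hper : Function.minimalPeriod (ρ s) x ∣ p ^ k := by
      apply Function.IsPeriodicPt.minimalPeriod_dvd
      rw [Function.IsPeriodicPt, Function.IsFixedPt, Equiv.Perm.iterate_eq_pow, ← map_pow, h1,
        Equiv.Perm.one_apply]
    obtain ⟨j, hj, hj'⟩ := (Nat.dvd_prime_pow (Fact.out : p.Prime)).1 hper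
    have hjk : j < k := lt_of_le_of_ne hj fun h => hx (by rw [hj', h])
    obtain ⟨l, rfl⟩ : ∃ l, k = l + 1 := ⟨k - 1, by omega⟩
    have hfix : ρ (s ^ p ^ l) x = x := by
      rw [map_pow, ← Equiv.Perm.iterate_eq_pow]
      refine Function.IsPeriodicPt.trans_dvd (Function.isPeriodicPt_minimalPeriod (ρ s) x) ?_
      rw [hj']
      exact pow_dvd_pow p (by omega)
    rw [pow_succ, pow_mul, cocycles.map_pow hD]
    rw [Finset.sum_congr rfl fun i _ => by rw [Function.iterate_fixed hfix i]]
    simp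

/-! ### Cocycles of presented groups -/

lemma cocycle_eq_zero_of_mem_normalClosure {p : ℕ} {G X : Type*} [Group G]
    {ρ : G →* Equiv.Perm X} {D : G → X → ZMod p} (hD : D ∈ cocycles p ρ) {R : Set G}
    (hρ : ∀ r ∈ R, ρ r = 1) (hR : ∀ r ∈ R, D r = 0) {g : G} (hg : g ∈ Subgroup.normalClosure R) :
    D g = 0 := by
  let N : Subgroup G :=
    { carrier := {g | ρ g = 1 ∧ D g = 0}
      one_mem' := ⟨map_one ρ, funext fun x => cocycles.map_one hD x⟩
      mul_mem' := by
        rintro g h ⟨hg, hg'⟩ ⟨hh, hh'⟩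
        exact ⟨by rw [map_mul, hg, hh, one_mul], funext fun x => by
          rw [cocycles.map_mul hD, hg', hh']; simp⟩
      inv_mem' := by
        rintro g ⟨hg, hg'⟩
        exact ⟨by rw [map_inv, hg, inv_one], funext fun x => by
          rw [cocycles.map_inv hD, hg']; simp⟩ }
  have hN : N.Normal := by
    refine ⟨?_⟩
    rintro n ⟨hn, hn'⟩ g
    refine ⟨by rw [map_mul, map_mul, hn, mul_one, ← map_mul, mul_inv_cancel, map_one],
      funext fun x => ?_⟩
    have h := cocycles.map_mul hD g g⁻¹ x
    rw [mul_inv_cancel, cocycles.map_one hD] at h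
    rw [cocycles.map_mul hD, cocycles.map_mul hD, hn', hn, Pi.zero_apply, Pi.zero_apply, add_zero,
      Equiv.Perm.one_apply, ← h]
  exact (Subgroup.normalClosure_le_normal (N := N) (fun r hr => ⟨hρ r hr, hR r hr⟩) hg).2

/-- The cocycles of the quotient of `F` by the normal closure of `R` are the cocycles of `F` that
vanish on `R`. -/
lemma card_cocycles_quotient {p : ℕ} {F Γ X : Type*} [Group F] [Group Γ] (π : F →* Γ)
    (hπ : Function.Surjective π) {R : Set F} (hR : π.ker = Subgroup.normalClosure R)
    (ρ : Γ →* Equiv.Perm X) :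
    Nat.card (cocycles p ρ) =
      Nat.card {D : cocycles p (ρ.comp π) // ∀ r ∈ R, D.1 r = 0} := by
  have hR1 : ∀ r ∈ R, π r = 1 := fun r hr => by
    rw [← MonoidHom.mem_ker, hR]; exact Subgroup.subset_normalClosure hr
  refine Nat.card_congr (Equiv.ofBijective (fun D => ⟨⟨fun g => D.1 (π g), fun g h x => ?_⟩,
    fun r hr => ?_⟩) ⟨fun D E h => ?_, ?_⟩)
  · simp only [map_mul, cocycles.map_mul D.2]; rfl
  · funext x
    simp only [hR1 r hr, cocycles.map_one D.2, Pi.zero_apply]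
  · refine Subtype.ext (funext fun γ => ?_)
    obtain ⟨g, rfl⟩ := hπ γ
    exact congrFun (congrArg (fun D => D.1.1) h) g
  · rintro ⟨⟨D, hD⟩, h0⟩
    have hzero : ∀ g, π g = 1 → D g = 0 := fun g hg =>
      cocycle_eq_zero_of_mem_normalClosure hD
        (fun r hr => by rw [MonoidHom.comp_apply, hR1 r hr, map_one]) h0
        (by rwa [← hR, MonoidHom.mem_ker])
    have hwd : ∀ g h, π g = π h → D g = D h := by
      intro g h hgh
      funext x
      have a := cocycles.map_mul hD h (h⁻¹ * g) x
      have b : π (h⁻¹ * g) = 1 := by rw [map_mul, map_inv, hgh, inv_mul_cancel]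
      rw [mul_inv_cancel_left, hzero _ b, MonoidHom.comp_apply, b, map_one,
        Equiv.Perm.one_apply] at a
      simpa using a
    refine ⟨⟨fun γ => D (Function.surjInv hπ γ), fun γ δ x => ?_⟩, ?_⟩
    · have := hwd (Function.surjInv hπ (γ * δ)) (Function.surjInv hπ γ * Function.surjInv hπ δ)
        (by simp only [map_mul, Function.surjInv_eq])
      simp only [this, cocycles.map_mul hD, MonoidHom.comp_apply, Function.surjInv_eq]
    · exact Subtype.ext (Subtype.ext (funext fun g => hwd _ _ (Function.surjInv_eq hπ _)))

/-- A family of finitely many linear conditions, the `i`-th one with values in `W i`, cuts out a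
subspace of codimension at most `∑ dim (W i)`. -/
lemma finrank_le_finrank_iInf_ker_add {k V A ι : Type*} [Field k] [AddCommGroup V] [Module k V]
    [AddCommGroup A] [Module k A] [Module.Finite k V] [Module.Finite k A] [Fintype ι]
    (L : ι → V →ₗ[k] A) (W : ι → Submodule k A) (h : ∀ i v, L i v ∈ W i) :
    Module.finrank k V ≤
      Module.finrank k (⨅ i, LinearMap.ker (L i) : Submodule k V) +
        ∑ i, Module.finrank k (W i) := by
  let Φ : V →ₗ[k] (∀ i, W i) := LinearMap.pi fun i => (L i).codRestrict (W i) (h i)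
  have hker : LinearMap.ker Φ = ⨅ i, LinearMap.ker (L i) := by
    rw [LinearMap.ker_pi]
    simp only [LinearMap.ker_codRestrict]
  have h1 := LinearMap.finrank_range_add_finrank_ker Φ
  have h2 := Submodule.finrank_le (LinearMap.range Φ)
  rw [Module.finrank_pi_fintype] at h2
  rw [hker] at h1
  omega

/-- The supremum defining the `p`-order is attained or infinite. -/
lemma exists_pow_eq_of_pOrder {p : ℕ} (hp : p.Prime) {F : Type*} [Group F] (r : F) (N : ℕ) :
    ∃ (k : ℕ) (s : F), s ^ p ^ k = r ∧
      (pOrder p r = k ∨ pOrder p r = ⊤ ∧ N < p ^ k) := by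
  let S : Set ℕ := {k | ∃ s : F, s ^ p ^ k = r}
  have hle : ∀ k ∈ S, (k : ℕ∞) ≤ pOrder p r := fun k hk =>
    le_iSup₂_of_le (f := fun (k : ℕ) (_ : ∃ s : F, s ^ p ^ k = r) => (k : ℕ∞)) k hk le_rfl
  have h0 : S.Nonempty := ⟨0, r, by simp⟩
  by_cases hb : BddAbove S
  · obtain ⟨s, hs⟩ := Nat.sSup_mem h0 hb
    refine ⟨sSup S, s, hs, Or.inl (le_antisymm (iSup₂_le fun k hk => ?_) (hle _ ⟨s, hs⟩))⟩
    exact_mod_cast le_csSup hb hk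
  · rw [not_bddAbove_iff] at hb
    obtain ⟨k, ⟨s, hs⟩, hk⟩ := hb N
    refine ⟨k, s, hs, Or.inr ⟨?_, hk.trans (Nat.lt_pow_self hp.one_lt)⟩⟩
    rw [ENat.eq_top_iff_forall_ge]
    intro j
    obtain ⟨l, hl, hjl⟩ := hb j
    exact le_trans (by exact_mod_cast hjl.le) (hle l hl)

lemma pNegPow_coe (p k : ℕ) : pNegPow p (k : ℕ∞) = ((p : ℝ≥0∞) ^ k)⁻¹ := rfl

/-- A relator `r` imposes at most `|X| * p ^ (-ν_p(r))` linear conditions on the cocycles with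
values in the functions on `X`. -/
lemma exists_submodule_relator {p : ℕ} [Fact p.Prime] {F X : Type*} [Group F] [Finite X]
    (ρ : F →* Equiv.Perm X) (r : F) (hr : ρ r = 1) :
    ∃ W : Submodule (ZMod p) (X → ZMod p), (∀ D ∈ cocycles p ρ, D r ∈ W) ∧
      (Module.finrank (ZMod p) W : ℝ≥0∞) ≤ Nat.card X * pNegPow p (pOrder p r) := by
  have hp : p.Prime := Fact.out
  obtain ⟨k, s, rfl, h⟩ := exists_pow_eq_of_pOrder hp r (Nat.card X)
  refine ⟨cycleFunctions p (ρ s) (p ^ k),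
    fun D hD => cocycle_pow_mem_cycleFunctions hD s k hr, ?_⟩
  have hW := finrank_cycleFunctions_mul_le (p := p) (ρ s) (p ^ k)
  rcases h with h | ⟨h, hk⟩
  · rw [h, pNegPow_coe, ← div_eq_mul_inv, ENNReal.le_div_iff_mul_le]
    · exact_mod_cast hW
    · left; exact_mod_cast (pow_pos hp.pos k).ne'
    · left; exact ENNReal.pow_ne_top (ENNReal.natCast_ne_top p)
  · have : Module.finrank (ZMod p) (cycleFunctions p (ρ s) (p ^ k)) = 0 := by
      by_contra h0
      have := Nat.le_mul_of_pos_left (p ^ k) (Nat.pos_of_ne_zero h0)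
      omega
    rw [this]
    simp

instance finite_cocycles_freeGroup {p : ℕ} [Fact p.Prime] {α X : Type*} [Finite α] [Finite X]
    (ρ : FreeGroup α →* Equiv.Perm X) : Module.Finite (ZMod p) (cocycles p ρ) :=
  Module.Finite.equiv (freeCocyclesEquiv p ρ).symm

lemma finrank_cocycles_freeGroup {p : ℕ} [Fact p.Prime] {α X : Type*} [Finite α] [Finite X]
    (ρ : FreeGroup α →* Equiv.Perm X) :
    Module.finrank (ZMod p) (cocycles p ρ) = Nat.card α * Nat.card X := by
  have := Fintype.ofFinite α
  have := Fintype.ofFinite X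
  rw [(freeCocyclesEquiv p ρ).finrank_eq, Module.finrank_pi_fintype]
  simp

/-- The relators with `p`-order greater than `log_p |X|` impose no conditions, so that only finitely
many relators matter when `∑ p ^ (-ν_p(r))` converges. -/
lemma exists_nat_card_cocycles_ge {p : ℕ} [Fact p.Prime] {m : ℕ} {Γ X : Type*} [Group Γ] [Finite X]
    (π : FreeGroup (Fin m) →* Γ) (hπ : Function.Surjective π) {R : Set (FreeGroup (Fin m))}
    (hR : π.ker = Subgroup.normalClosure R)
    (hS : ∑' r : R, pNegPow p (pOrder p (r : FreeGroup (Fin m))) ≠ ⊤) (ρ : Γ →* Equiv.Perm X) :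
    ∃ e s : ℕ, Nat.card (cocycles p ρ) = p ^ e ∧ m * Nat.card X ≤ e + s ∧
      (s : ℝ≥0∞) ≤ Nat.card X * ∑' r : R, pNegPow p (pOrder p (r : FreeGroup (Fin m))) := by
  classical
  have hR1 : ∀ r ∈ R, (ρ.comp π) r = 1 := fun r hr => by
    have : r ∈ π.ker := hR ▸ Subgroup.subset_normalClosure hr
    rw [MonoidHom.comp_apply, MonoidHom.mem_ker.1 this, map_one]
  choose W hW hWr using fun r : R => exists_submodule_relator (p := p) (ρ.comp π) r (hR1 r r.2)
  have htop : ∑' r : R, (Module.finrank (ZMod p) (W r) : ℝ≥0∞) ≤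
      Nat.card X * ∑' r : R, pNegPow p (pOrder p (r : FreeGroup (Fin m))) := by
    rw [← ENNReal.tsum_mul_left]
    exact ENNReal.tsum_le_tsum hWr
  have hfin := ENNReal.finite_const_le_of_tsum_ne_top
    (ne_top_of_le_ne_top (ENNReal.mul_ne_top (ENNReal.natCast_ne_top _) hS) htop) one_ne_zero
  have := hfin.fintype
  let L : R → cocycles p (ρ.comp π) →ₗ[ZMod p] (X → ZMod p) := fun r =>
    (LinearMap.proj (r : FreeGroup (Fin m))).comp (cocycles p (ρ.comp π)).subtype
  set R₀ := {r : R | 1 ≤ (Module.finrank (ZMod p) (W r) : ℝ≥0∞)}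
  have hdim := finrank_le_finrank_iInf_ker_add (fun r : R₀ => L r) (fun r => W r)
    fun r D => hW r D.1 D.2
  rw [finrank_cocycles_freeGroup, Nat.card_fin] at hdim
  refine ⟨_, _, ?_, hdim, ?_⟩
  · rw [card_cocycles_quotient π hπ hR ρ]
    have hmem : ∀ D : cocycles p (ρ.comp π),
        (∀ r ∈ R, D.1 r = 0) ↔ D ∈ (⨅ r : R₀, LinearMap.ker (L r)) := by
      intro D
      simp only [Submodule.mem_iInf, LinearMap.mem_ker]
      refine ⟨fun h r => h _ r.1.2, fun h r hr => ?_⟩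
      by_cases hr0 : (⟨r, hr⟩ : R) ∈ R₀
      · exact h ⟨_, hr0⟩
      · have h0 : Module.finrank (ZMod p) (W ⟨r, hr⟩) = 0 := by
          by_contra h0
          exact hr0 (by
            change (1 : ℝ≥0∞) ≤ _
            exact_mod_cast Nat.pos_of_ne_zero h0)
        have := hW ⟨r, hr⟩ D.1 D.2
        rw [Submodule.finrank_eq_zero.1 h0] at this
        exact this
    rw [Nat.card_congr (Equiv.subtypeEquivRight hmem)]
    have := Module.natCard_eq_pow_finrank (K := ZMod p)
      (V := (⨅ r : R₀, LinearMap.ker (L r) : Submodule (ZMod p) (cocycles p (ρ.comp π))))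
    rw [Nat.card_zmod] at this
    exact this
  · refine le_trans ?_ htop
    push_cast
    rw [← tsum_fintype (L := .unconditional _)]
    exact ENNReal.tsum_comp_le_tsum_of_injective Subtype.val_injective
      (fun r : R => (Module.finrank (ZMod p) (W r) : ℝ≥0∞))

/-! ### Homomorphisms to the group of order `p` and the `p`-deficiency -/

lemma restrict_injective {G A : Type*} [Group G] [Group A] {S : Set G}
    (hS : Subgroup.closure S = ⊤) :
    Function.Injective (fun (φ : G →* A) (s : S) => φ s) := fun _ _ h =>
  MonoidHom.eq_of_eqOn_dense hS fun s hs => congrFun h ⟨s, hs⟩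

lemma finite_monoidHom (G A : Type*) [Group G] [Group.FG G] [Group A] [Finite A] :
    Finite (G →* A) := by
  obtain ⟨S, -, hS⟩ := Group.rank_spec G
  exact Finite.of_injective _ (restrict_injective (A := A) hS)

lemma card_hom_zmod_le {p : ℕ} [Fact p.Prime] (G : Type*) [Group G] [Group.FG G] :
    Nat.card (G →* Multiplicative (ZMod p)) ≤ p ^ Group.rank G := by
  obtain ⟨S, hS', hS⟩ := Group.rank_spec G
  have := Nat.card_le_card_of_injective _ (restrict_injective (A := Multiplicative (ZMod p)) hS)
  rw [← hS']
  rw [Nat.card_fun] at this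
  simpa using this

lemma one_le_card_hom {p : ℕ} [Fact p.Prime] (G : Type*) [Group G] [Group.FG G] :
    1 ≤ Nat.card (G →* Multiplicative (ZMod p)) := by
  have := finite_monoidHom G (Multiplicative (ZMod p))
  exact Nat.card_pos

lemma card_hom_subgroup_freeGroup {p : ℕ} [Fact p.Prime] {d : ℕ} (hd : 1 ≤ d)
    (H : Subgroup (FreeGroup (Fin d))) [H.FiniteIndex] :
    Nat.card (H →* Multiplicative (ZMod p)) = p ^ (1 + (d - 1) * H.index) := by
  have h := card_cocycles_mul (p := p) H
  have hp : 0 < p := (Fact.out : p.Prime).pos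
  have h2 := Module.natCard_eq_pow_finrank (K := ZMod p)
    (V := cocycles p (MulAction.toPermHom (FreeGroup (Fin d)) (FreeGroup (Fin d) ⧸ H)))
  rw [finrank_cocycles_freeGroup, Nat.card_zmod, Nat.card_fin] at h2
  change _ = p ^ (d * H.index) at h2
  rw [h2] at h
  obtain ⟨e, rfl⟩ : ∃ e, d = e + 1 := ⟨d - 1, by omega⟩
  refine Nat.eq_of_mul_eq_mul_right (pow_pos hp H.index) ?_
  rw [← h, ← pow_succ, ← pow_add]
  congr 1
  simp only [Nat.add_sub_cancel]
  ring

lemma presentationPDeficiency_of_ne_top {p m : ℕ} {R : Set (FreeGroup (Fin m))}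
    (hS : ∑' r : R, pNegPow p (pOrder p (r : FreeGroup (Fin m))) ≠ ⊤) :
    presentationPDeficiency p m R =
      ((m - 1 - (∑' r : R, pNegPow p (pOrder p (r : FreeGroup (Fin m)))).toReal : ℝ) : EReal) := by
  unfold presentationPDeficiency
  rw [← EReal.coe_toReal
    (x := ((∑' r : R, pNegPow p (pOrder p (r : FreeGroup (Fin m))) : ℝ≥0∞) : EReal))]
  · simp
  · simpa using hS
  · simp

lemma presentationPDeficiency_of_eq_top {p m : ℕ} {R : Set (FreeGroup (Fin m))}
    (hS : ∑' r : R, pNegPow p (pOrder p (r : FreeGroup (Fin m))) = ⊤) :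
    presentationPDeficiency p m R = ⊥ := by
  unfold presentationPDeficiency
  rw [hS, EReal.coe_ennreal_top, EReal.sub_top]

/-- The projection of a free group onto a group presented by generators and relators. -/
lemma exists_presentation_hom {m : ℕ} {R : Set (FreeGroup (Fin m))} {Γ : Type*} [Group Γ]
    (e : PresentedGroup R ≃* Γ) :
    ∃ π : FreeGroup (Fin m) →* Γ, Function.Surjective π ∧ π.ker = Subgroup.normalClosure R := by
  refine ⟨e.toMonoidHom.comp (PresentedGroup.mk R),
    e.surjective.comp (PresentedGroup.mk_surjective R), ?_⟩
  ext g
  rw [MonoidHom.mem_ker, MonoidHom.comp_apply, MulEquiv.toMonoidHom_eq_coe, MonoidHom.coe_coe,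
    EmbeddingLike.map_eq_one_iff]
  exact QuotientGroup.eq_one_iff g

/-- For every presentation of `Γ`, a subgroup of index `n` has at least
`p ^ (1 + n * def)` homomorphisms to `ZMod p`, where `def` is the `p`-deficiency of the
presentation. -/
lemma rpow_le_card_hom {p : ℕ} [Fact p.Prime] {m : ℕ} {R : Set (FreeGroup (Fin m))} {Γ : Type*}
    [Group Γ] (e : PresentedGroup R ≃* Γ) (H : Subgroup Γ) [H.FiniteIndex]
    (hS : ∑' r : R, pNegPow p (pOrder p (r : FreeGroup (Fin m))) ≠ ⊤) :
    (p : ℝ) ^ (1 + H.index *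
      (m - 1 - (∑' r : R, pNegPow p (pOrder p (r : FreeGroup (Fin m)))).toReal) : ℝ) ≤
      Nat.card (H →* Multiplicative (ZMod p)) := by
  have hp : p.Prime := Fact.out
  have hp1 : (1 : ℝ) ≤ p := by exact_mod_cast hp.one_le
  have hp0 : (0 : ℝ) < p := by exact_mod_cast hp.pos
  obtain ⟨π, hπ, hker⟩ := exists_presentation_hom e
  obtain ⟨a, s, ha, has, hs⟩ := exists_nat_card_cocycles_ge (p := p) π hπ hker hS
    (MulAction.toPermHom Γ (Γ ⧸ H))
  have h := card_cocycles_mul (p := p) H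
  rw [ha] at h
  change m * H.index ≤ _ at has
  change _ ≤ (H.index : ℝ≥0∞) * _ at hs
  have hs' := ENNReal.toReal_mono (ENNReal.mul_ne_top (ENNReal.natCast_ne_top _) hS) hs
  rw [ENNReal.toReal_natCast, ENNReal.toReal_mul, ENNReal.toReal_natCast] at hs'
  have h' : (p : ℝ) ^ (a + 1 : ℝ) =
      Nat.card (H →* Multiplicative (ZMod p)) * (p : ℝ) ^ (H.index : ℝ) := by
    rw [Real.rpow_natCast, Real.rpow_add_one hp0.ne', Real.rpow_natCast]
    exact_mod_cast h
  have hle : (1 + H.index *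
      (m - 1 - (∑' r : R, pNegPow p (pOrder p (r : FreeGroup (Fin m)))).toReal) : ℝ) ≤
      a + 1 - H.index := by
    have : (m * H.index : ℝ) ≤ a + s := by exact_mod_cast has
    linarith
  calc _ ≤ (p : ℝ) ^ (a + 1 - H.index : ℝ) := Real.rpow_le_rpow_of_exponent_le hp1 hle
    _ = _ := by
      rw [Real.rpow_sub hp0, h', mul_div_cancel_right₀ _ (Real.rpow_pos_of_pos hp0 _).ne']

lemma pDeficiency_le {p : ℕ} [Fact p.Prime] {Γ : Type*} [Group Γ] (H : Subgroup Γ)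
    [H.FiniteIndex] :
    pDeficiency p Γ ≤
      (((Real.logb p (Nat.card (H →* Multiplicative (ZMod p))) - 1) / H.index : ℝ) : EReal) := by
  have hp : p.Prime := Fact.out
  have hp1 : (1 : ℝ) < p := by exact_mod_cast hp.one_lt
  refine iSup_le fun m => iSup₂_le fun R ⟨e⟩ => ?_
  by_cases hS : ∑' r : R, pNegPow p (pOrder p (r : FreeGroup (Fin m))) = ⊤
  · rw [presentationPDeficiency_of_eq_top hS]
    exact bot_le
  · rw [presentationPDeficiency_of_ne_top hS, EReal.coe_le_coe_iff]
    have h := rpow_le_card_hom (p := p) e H hS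
    have hpos := (Real.rpow_pos_of_pos (zero_lt_one.trans hp1) _).trans_le h
    rw [← Real.le_logb_iff_rpow_le hp1 hpos] at h
    have hn : (0 : ℝ) < H.index := by
      exact_mod_cast Nat.pos_of_ne_zero Subgroup.FiniteIndex.index_ne_zero
    rw [le_div_iff₀ hn]
    linarith

lemma fg_of_pDeficiency_ne_bot {p : ℕ} {Γ : Type*} [Group Γ] (h : pDeficiency p Γ ≠ ⊥) :
    Group.FG Γ := by
  by_contra hfg
  refine h (eq_bot_iff.2 (iSup_le fun m => iSup₂_le fun R ⟨e⟩ => ?_))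
  obtain ⟨π, hπ, -⟩ := exists_presentation_hom e
  exact absurd (Group.fg_of_surjective hπ) hfg

/-! ### The rank gradient -/

theorem pDeficiency_le_rankGradient {p : ℕ} [Fact p.Prime] (Γ : Type*) [Group Γ] [Group.FG Γ] :
    pDeficiency p Γ ≤ (rankGradient Γ : EReal) := by
  have hp1 : (1 : ℝ) < p := by exact_mod_cast (Fact.out : p.Prime).one_lt
  rcases le_total (pDeficiency p Γ) 0 with h0 | h0
  · exact h0.trans (EReal.coe_ennreal_nonneg _)
  rw [← EReal.coe_toENNReal h0, EReal.coe_ennreal_le_coe_ennreal_iff]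
  refine le_iInf fun S => Filter.le_liminf_of_le (by isBoundedDefault)
    (Filter.Eventually.of_forall fun i => ?_)
  have hn : (0 : ℝ) < (S.N i).index := by
    exact_mod_cast Nat.pos_of_ne_zero Subgroup.FiniteIndex.index_ne_zero
  have hc : (1 : ℝ) ≤ Nat.card (S.N i →* Multiplicative (ZMod p)) := by
    exact_mod_cast one_le_card_hom (p := p) (S.N i)
  have hle : (Real.logb p (Nat.card (S.N i →* Multiplicative (ZMod p))) - 1) / (S.N i).index ≤
      (Group.rank (S.N i) : ℝ) / (S.N i).index := by
    have hr : (Nat.card (S.N i →* Multiplicative (ZMod p)) : ℝ) ≤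
        (p : ℝ) ^ (Group.rank (S.N i) : ℝ) := by
      rw [Real.rpow_natCast]
      exact_mod_cast card_hom_zmod_le (p := p) (S.N i)
    rw [← Real.logb_le_iff_le_rpow hp1 (by linarith)] at hr
    gcongr
    linarith
  have h := (pDeficiency_le (p := p) (S.N i)).trans (EReal.coe_le_coe_iff.2 hle)
  rw [← EReal.coe_ennreal_le_coe_ennreal_iff, EReal.coe_toENNReal h0]
  refine h.trans (le_of_eq ?_)
  rw [← ENNReal.toReal_natCast, ← ENNReal.toReal_natCast, ← ENNReal.toReal_div,
    EReal.coe_ennreal_toReal]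
  exact ENNReal.div_ne_top (ENNReal.natCast_ne_top _) (by exact_mod_cast hn.ne')

/-! ### Groups of large `p`-deficiency in which all elements have `p`-power order -/

lemma pNegPow_antitone {p : ℕ} (hp : p.Prime) {k : ℕ} {a : ℕ∞} (h : (k : ℕ∞) ≤ a) :
    pNegPow p a ≤ ((p : ℝ≥0∞) ^ k)⁻¹ := by
  induction a using ENat.recTopCoe with
  | top => exact zero_le
  | coe a =>
    rw [pNegPow_coe]
    gcongr
    · exact_mod_cast hp.one_le
    · exact_mod_cast h

/-- The relators `g ^ p ^ (k + i)`, where `g` is the element of the free group given by the `i`-th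
word. -/
def powerRelators (p d k : ℕ) : Set (FreeGroup (Fin d)) :=
  Set.range fun w : List (Fin d × Bool) => FreeGroup.mk w ^ p ^ (k + Encodable.encode w)

lemma tsum_powerRelators_le {p : ℕ} (hp : p.Prime) (d k : ℕ) :
    ∑' r : powerRelators p d k, pNegPow p (pOrder p (r : FreeGroup (Fin d))) ≤
      2 * (2⁻¹ : ℝ≥0∞) ^ k := by
  choose w hw using fun r : powerRelators p d k => r.2
  have hinj : Function.Injective (fun r => Encodable.encode (w r)) := by
    intro r s h
    ext
    rw [← hw r, ← hw s, Encodable.encode_injective h]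
  calc _ ≤ ∑' r : powerRelators p d k, (2⁻¹ : ℝ≥0∞) ^ (k + Encodable.encode (w r)) := by
        refine ENNReal.tsum_le_tsum fun r => ?_
        refine (pNegPow_antitone hp (k := k + Encodable.encode (w r)) ?_).trans ?_
        · exact le_iSup₂_of_le (f := fun (k : ℕ) (_ : ∃ s, s ^ p ^ k = r.1) => (k : ℕ∞)) _
            ⟨FreeGroup.mk (w r), hw r⟩ le_rfl
        · rw [← ENNReal.inv_pow]
          gcongr
          exact_mod_cast hp.two_le
    _ ≤ ∑' i : ℕ, (2⁻¹ : ℝ≥0∞) ^ (k + i) :=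
        ENNReal.tsum_comp_le_tsum_of_injective hinj fun i => (2⁻¹ : ℝ≥0∞) ^ (k + i)
    _ = 2 * (2⁻¹ : ℝ≥0∞) ^ k := by
        simp_rw [pow_add]
        rw [ENNReal.tsum_mul_left, ENNReal.tsum_geometric, ENNReal.one_sub_inv_two, inv_inv,
          mul_comm]

lemma isPGroup_presentedGroup_powerRelators (p d k : ℕ) :
    IsPGroup p (PresentedGroup (powerRelators p d k)) := by
  intro γ
  obtain ⟨g, rfl⟩ := PresentedGroup.mk_surjective _ γ
  refine ⟨k + Encodable.encode g.toWord, ?_⟩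
  rw [← map_pow]
  exact (QuotientGroup.eq_one_iff _).2
    (Subgroup.subset_normalClosure ⟨g.toWord, by simp only [FreeGroup.mk_toWord]⟩)

instance fg_presentedGroup {α : Type*} [Finite α] (R : Set (FreeGroup α)) :
    Group.FG (PresentedGroup R) :=
  Group.fg_of_surjective (PresentedGroup.mk_surjective R)

/-- All relators are `p`-th powers if `k ≥ 1`, so that they do not restrict the homomorphisms to
`ZMod p`. -/
lemma le_card_hom_powerRelators (p d k : ℕ) [Fact p.Prime] (hk : 1 ≤ k) :
    p ^ d ≤ Nat.card (PresentedGroup (powerRelators p d k) →* Multiplicative (ZMod p)) := by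
  have hrel : ∀ f : Fin d → Multiplicative (ZMod p), ∀ r ∈ powerRelators p d k,
      FreeGroup.lift f r = 1 := by
    rintro f _ ⟨w, rfl⟩
    dsimp only
    obtain ⟨l, hl⟩ : ∃ l, k + Encodable.encode w = l + 1 := ⟨k + Encodable.encode w - 1, by omega⟩
    rw [map_pow, hl, pow_succ', pow_mul]
    have : (FreeGroup.lift f (FreeGroup.mk w)) ^ p = 1 := by
      apply Multiplicative.toAdd.injective
      simp
    rw [this, one_pow]
  have hinj : Function.Injective fun f => PresentedGroup.toGroup (hrel f) := by
    intro f f' h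
    funext i
    have := DFunLike.congr_fun h (PresentedGroup.of i)
    simpa using this
  have := finite_monoidHom (PresentedGroup (powerRelators p d k)) (Multiplicative (ZMod p))
  have := Nat.card_le_card_of_injective _ hinj
  simpa using this

lemma rank_powerRelators (p d k : ℕ) [Fact p.Prime] (hk : 1 ≤ k) :
    Group.rank (PresentedGroup (powerRelators p d k)) = d := by
  refine le_antisymm ?_ ?_
  · classical
    let S : Finset (PresentedGroup (powerRelators p d k)) :=
      Finset.univ.image PresentedGroup.of
    have hS : Subgroup.closure (S : Set (PresentedGroup (powerRelators p d k))) = ⊤ := by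
      simp [S]
    exact (Group.rank_le hS).trans (Finset.card_image_le.trans (by simp))
  · have := (le_card_hom_powerRelators p d k hk).trans (card_hom_zmod_le _)
    exact (Nat.pow_le_pow_iff_right (Fact.out : p.Prime).one_lt).1 this

theorem exists_isPGroup_pDeficiency_ge {p : ℕ} [Fact p.Prime] (d : ℕ) {ε : ℝ}
    (hε : 0 < ε) :
    ∃ (Γ : Type) (_ : Group Γ) (_ : Group.FG Γ),
      Group.rank Γ = d ∧ IsPGroup p Γ ∧ (((d : ℝ) - 1 - ε : ℝ) : EReal) ≤ pDeficiency p Γ ∧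
      p ^ d ≤ Nat.card (Γ →* Multiplicative (ZMod p)) := by
  have hp : p.Prime := Fact.out
  obtain ⟨k, hk⟩ := exists_pow_lt_of_lt_one (half_pos hε) (by norm_num : (2⁻¹ : ℝ) < 1)
  have hk1 : 1 ≤ k + 1 := by omega
  refine ⟨PresentedGroup (powerRelators p d (k + 1)), inferInstance, inferInstance,
    rank_powerRelators p d _ hk1, isPGroup_presentedGroup_powerRelators _ _ _, ?_,
    le_card_hom_powerRelators p d _ hk1⟩
  have h := tsum_powerRelators_le hp d (k + 1)
  have htop : (2 * (2⁻¹ : ℝ≥0∞) ^ (k + 1)) ≠ ⊤ := by simp [ENNReal.mul_eq_top]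
  refine le_iSup_of_le d (le_iSup₂_of_le (powerRelators p d (k + 1)) ⟨MulEquiv.refl _⟩ ?_)
  rw [presentationPDeficiency_of_ne_top (ne_top_of_le_ne_top htop h), EReal.coe_le_coe_iff]
  have h' := ENNReal.toReal_mono htop h
  simp only [ENNReal.toReal_mul, ENNReal.toReal_pow, ENNReal.toReal_inv, ENNReal.toReal_ofNat]
    at h'
  rw [pow_succ] at h'
  linarith

/-! ### Counting subnormal subgroups -/

lemma finite_setOf_index_eq (G : Type*) [Group G] [Group.FG G] {k : ℕ} (hk : k ≠ 0) :
    {H : Subgroup G | H.index = k}.Finite := by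
  have := finite_monoidHom G (Equiv.Perm (Fin k))
  refine Set.Finite.subset (Set.finite_range fun y : (G →* Equiv.Perm (Fin k)) × Fin k =>
    (MulAction.stabilizer (Equiv.Perm (Fin k)) y.2).comap y.1) ?_
  rintro H (rfl : H.index = k)
  have hfin : H.FiniteIndex := ⟨hk⟩
  let e : G ⧸ H ≃ Fin H.index := Finite.equivFin (G ⧸ H)
  refine ⟨⟨e.permCongrHom.toMonoidHom.comp (MulAction.toPermHom G (G ⧸ H)),
    e ((1 : G) : G ⧸ H)⟩, ?_⟩
  ext g
  simp only [Subgroup.mem_comap, MulAction.mem_stabilizer_iff, MonoidHom.comp_apply,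
    Equiv.Perm.smul_def]
  change e (g • e.symm (e ((1 : G) : G ⧸ H))) = e ((1 : G) : G ⧸ H) ↔ _
  rw [e.symm_apply_apply, e.apply_eq_iff_eq, MulAction.Quotient.smul_coe, smul_eq_mul, mul_one,
    eq_comm, QuotientGroup.eq, inv_one, one_mul]

section Kernel

variable {p : ℕ} [Fact p.Prime] {G : Type*} [Group G] {H : Subgroup G}
  {φ : H →* Multiplicative (ZMod p)}

lemma surjective_of_ne_one (hφ : φ ≠ 1) : Function.Surjective φ := by
  have hc : Nat.card (Multiplicative (ZMod p)) = p := by simp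
  have : Fact (Nat.card (Multiplicative (ZMod p))).Prime := by rw [hc]; infer_instance
  rcases Subgroup.eq_bot_or_eq_top_of_prime_card φ.range with h | h
  · exact absurd (MonoidHom.range_eq_bot_iff.1 h) hφ
  · exact MonoidHom.range_eq_top.1 h

/-- The kernel of a homomorphism `H → ZMod p`, as a subgroup of the ambient group. -/
def ambientKer (φ : H →* Multiplicative (ZMod p)) : Subgroup G := φ.ker.map H.subtype

lemma ambientKer_le : ambientKer φ ≤ H := Subgroup.map_subtype_le _

lemma mem_ambientKer (h : H) : (h : G) ∈ ambientKer φ ↔ φ h = 1 := by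
  rw [ambientKer, ← MonoidHom.mem_ker]
  exact Subgroup.mem_map_iff_mem H.subtype_injective

lemma ambientKer_subgroupOf : (ambientKer φ).subgroupOf H = φ.ker :=
  Subgroup.ext fun h => by rw [Subgroup.mem_subgroupOf, mem_ambientKer, MonoidHom.mem_ker]

lemma index_ambientKer (hφ : φ ≠ 1) : (ambientKer φ).index = p * H.index := by
  rw [← Subgroup.relIndex_mul_index (ambientKer_le (φ := φ)), Subgroup.relIndex,
    ambientKer_subgroupOf, Subgroup.index_ker, MonoidHom.range_eq_top.2 (surjective_of_ne_one hφ)]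
  simp

lemma isSubnormal_ambientKer (hH : H.IsSubnormal) : (ambientKer φ).IsSubnormal :=
  Subgroup.IsSubnormal.step _ H ambientKer_le hH (by rw [ambientKer_subgroupOf]; infer_instance)

/-- An element `h` with `φ h` the generator `1` generates `H` modulo the kernel of `φ`. -/
lemma exists_eq_pow_mul {h x : H} (h1 : φ h = Multiplicative.ofAdd 1) :
    ∃ k ∈ ambientKer φ, (x : G) = (h : G) ^ (φ x).toAdd.val * k := by
  refine ⟨((h ^ (φ x).toAdd.val)⁻¹ * x : H), ?_, by simp⟩
  rw [mem_ambientKer, map_mul, map_inv, map_pow, h1, ← ofAdd_nsmul]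
  simp

/-- A homomorphism `H → ZMod p` is determined by its kernel `K` and the coset `h K` on which it
takes the value `1`; even its domain `H` is determined. -/
lemma eq_of_ambientKer_eq {H' : Subgroup G} {φ' : H' →* Multiplicative (ZMod p)}
    (hK : ambientKer φ = ambientKer φ') {h : H} {h' : H'} (h1 : φ h = Multiplicative.ofAdd 1)
    (h1' : φ' h' = Multiplicative.ofAdd 1) (hh : (h : G)⁻¹ * h' ∈ ambientKer φ) :
    (⟨H, φ⟩ : Σ H : Subgroup G, H →* Multiplicative (ZMod p)) = ⟨H', φ'⟩ := by
  have hle : H ≤ H' := by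
    intro x hx
    obtain ⟨k, hk, hxk⟩ := exists_eq_pow_mul (x := ⟨x, hx⟩) h1
    have hh' : (h : G) ∈ H' := by
      have := H'.mul_mem h'.2 (H'.inv_mem (ambientKer_le (hK ▸ hh)))
      simpa using this
    rw [show x = _ from hxk]
    exact H'.mul_mem (H'.pow_mem hh' _) (ambientKer_le (hK ▸ hk))
  have hle' : H' ≤ H := by
    intro x hx
    obtain ⟨k, hk, hxk⟩ := exists_eq_pow_mul (x := ⟨x, hx⟩) h1'
    have hh' : (h' : G) ∈ H := by
      have := H.mul_mem h.2 (ambientKer_le hh)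
      simpa using this
    rw [show x = _ from hxk]
    exact H.mul_mem (H.pow_mem hh' _) (ambientKer_le (hK ▸ hk))
  obtain rfl := le_antisymm hle hle'
  congr 1
  ext x
  obtain ⟨k, hk, hxk⟩ := exists_eq_pow_mul (x := x) h1
  obtain ⟨l, rfl⟩ : ∃ l : H, (l : G) = k := ⟨⟨k, ambientKer_le hk⟩, rfl⟩
  have hx : x = h ^ (φ x).toAdd.val * l := Subtype.ext hxk
  have hl : φ' l = 1 := by rw [← mem_ambientKer, ← hK]; exact hk
  have hhh : φ' h = φ' h' := by
    have : φ' (h⁻¹ * h') = 1 := by rw [← mem_ambientKer, ← hK]; exact hh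
    rw [map_mul, map_inv, inv_mul_eq_one] at this
    exact this
  have : φ' x = φ x := by
    conv_lhs => rw [hx]
    rw [map_mul, hl, mul_one, map_pow, hhh, h1', ← ofAdd_nsmul]
    simp
  rw [this]

end Kernel

/-- Double count of the pairs `(H, φ)` with `H` subnormal of index `p ^ n` and `φ : H → ZMod p`
nontrivial: such a pair is determined by the kernel `K` of `φ`, which is subnormal of index
`p ^ (n + 1)`, and a coset of `K`. -/
lemma subnormalCount_mul_le {p : ℕ} [Fact p.Prime] (G : Type*) [Group G] [Group.FG G] (n : ℕ)
    (c : ℝ) (hc : ∀ H : Subgroup G, H.IsSubnormal → H.index = p ^ n →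
      c + 1 ≤ Nat.card (H →* Multiplicative (ZMod p))) :
    subnormalCount G (p ^ n) * c ≤ subnormalCount G (p ^ (n + 1)) * p ^ (n + 1) := by
  classical
  have hp : p.Prime := Fact.out
  let T : ℕ → Set (Subgroup G) := fun n => {H | H.IsSubnormal ∧ H.index = p ^ n}
  have hT : ∀ n, (T n).Finite := fun n =>
    (finite_setOf_index_eq G (pow_pos hp.pos n).ne').subset fun H hH => hH.2
  have := fun n => (hT n).fintype
  have hfi : ∀ n, ∀ H : T n, H.1.FiniteIndex := fun n H =>
    ⟨by rw [H.2.2]; exact (pow_pos hp.pos n).ne'⟩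
  have hfin : ∀ H : T n, Finite (H.1 →* Multiplicative (ZMod p)) := fun H =>
    finite_monoidHom _ _
  have hq : ∀ K : T (n + 1), Finite (G ⧸ K.1) := fun K => inferInstance
  choose g hg using fun (y : Σ H : T n, {φ : H.1 →* Multiplicative (ZMod p) // φ ≠ 1}) =>
    surjective_of_ne_one y.2.2 (Multiplicative.ofAdd 1)
  let f : (Σ H : T n, {φ : H.1 →* Multiplicative (ZMod p) // φ ≠ 1}) →
      (Σ K : T (n + 1), G ⧸ K.1) := fun y =>
    ⟨⟨ambientKer y.2.1, isSubnormal_ambientKer y.1.2.1, by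
      rw [index_ambientKer y.2.2, y.1.2.2, pow_succ']⟩, (g y : G)⟩
  have hf : Function.Injective f := by
    intro y z hyz
    have h := congrArg (fun u : Σ K : T (n + 1), G ⧸ K.1 =>
      ((u.1.1, {a : G | (a : G ⧸ u.1.1) = u.2}) : Subgroup G × Set G)) hyz
    have h1 : ambientKer y.2.1 = ambientKer z.2.1 := congrArg Prod.fst h
    have h2 : {a : G | (a : G ⧸ ambientKer y.2.1) = (g y : G)} =
      {a : G | (a : G ⧸ ambientKer z.2.1) = (g z : G)} := congrArg Prod.snd h
    have h3 : ((g z : G) : G ⧸ ambientKer y.2.1) = (g y : G) := by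
      have : (g z : G) ∈ {a : G | (a : G ⧸ ambientKer z.2.1) = (g z : G)} := rfl
      rwa [← h2] at this
    have h4 := eq_of_ambientKer_eq h1 (hg y) (hg z) (QuotientGroup.eq.1 h3.symm)
    obtain ⟨⟨H, hH⟩, φ, hφ⟩ := y
    obtain ⟨⟨H', hH'⟩, φ', hφ'⟩ := z
    simp only [Sigma.mk.injEq] at h4
    obtain ⟨rfl, h5⟩ := h4
    obtain rfl := eq_of_heq h5
    rfl
  have hcard := Nat.card_le_card_of_injective f hf
  rw [Nat.card_sigma, Nat.card_sigma] at hcard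
  have hr : ∑ K : T (n + 1), Nat.card (G ⧸ K.1) = subnormalCount G (p ^ (n + 1)) * p ^ (n + 1) := by
    rw [Finset.sum_congr rfl fun K _ => (show Nat.card (G ⧸ K.1) = p ^ (n + 1) from K.2.2),
      Finset.sum_const, Finset.card_univ, ← Nat.card_eq_fintype_card, smul_eq_mul]
    rfl
  have hl : (subnormalCount G (p ^ n) * c : ℝ) ≤
      ∑ H : T n, (Nat.card {φ : H.1 →* Multiplicative (ZMod p) // φ ≠ 1} : ℝ) := by
    have : (subnormalCount G (p ^ n) : ℝ) * c = ∑ H : T n, c := by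
      rw [Finset.sum_const, Finset.card_univ, ← Nat.card_eq_fintype_card, nsmul_eq_mul]
      rfl
    rw [this]
    refine Finset.sum_le_sum fun H _ => ?_
    have h1 := hc H.1 H.2.1 H.2.2
    have := Fintype.ofFinite (H.1 →* Multiplicative (ZMod p))
    have h2 : Nat.card {φ : H.1 →* Multiplicative (ZMod p) // φ ≠ 1} + 1 =
        Nat.card (H.1 →* Multiplicative (ZMod p)) := by
      have := Fintype.card_subtype_compl (fun φ : H.1 →* Multiplicative (ZMod p) => φ = 1)
      rw [Nat.card_eq_fintype_card, Nat.card_eq_fintype_card, this, Fintype.card_subtype_eq]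
      exact Nat.sub_add_cancel Fintype.card_pos
    have h3 : (Nat.card {φ : H.1 →* Multiplicative (ZMod p) // φ ≠ 1} : ℝ) + 1 =
        Nat.card (H.1 →* Multiplicative (ZMod p)) := by exact_mod_cast h2
    linarith
  refine hl.trans ?_
  rw [hr] at hcard
  exact_mod_cast hcard

/-- Exponentials beat squares, in the form needed to absorb the lower order terms. -/
lemma exists_sq_le_mul_pow {p : ℕ} (hp : 1 < p) {η : ℝ} (hη : 0 < η) :
    ∃ C : ℝ, ∀ n : ℕ, (n : ℝ) ^ 2 ≤ η * (p : ℝ) ^ n + C := by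
  have h1 : (1 : ℝ) < p := by exact_mod_cast hp
  have ht := (isLittleO_pow_const_const_pow_of_one_lt (R := ℝ) 2 h1).def hη
  obtain ⟨N, hN⟩ := Filter.eventually_atTop.1 ht
  refine ⟨(N : ℝ) ^ 2, fun n => ?_⟩
  rcases le_total N n with h | h
  · have := hN n h
    simp only [norm_pow, Real.norm_natCast] at this
    nlinarith [sq_nonneg (N : ℝ)]
  · have : (n : ℝ) ^ 2 ≤ (N : ℝ) ^ 2 := by gcongr
    have := mul_pos hη (pow_pos (zero_lt_one.trans h1) n)
    linarith

lemma subnormalCount_one (G : Type*) [Group G] : subnormalCount G 1 = 1 := by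
  rw [subnormalCount, Set.ncard_eq_one]
  refine ⟨⊤, Set.ext fun H => ?_⟩
  simp only [Set.mem_ofPred_eq, Set.mem_singleton_iff, Subgroup.index_eq_one]
  exact ⟨fun h => h.2, fun h => ⟨h ▸ Subgroup.IsSubnormal.top, h⟩⟩

section Growth

variable {p : ℕ} [Fact p.Prime] {G : Type*} [Group G] [Group.FG G]

/-- If every subgroup of finite index `k` has at least `p ^ (1 + k * δ)` homomorphisms to `ZMod p`,
then the subnormal subgroups of index `p ^ n` number at least
`p ^ (δ (p ^ n - 1) / (p - 1) - n ^ 2)`, by multiplying up the ratios of successive counts. -/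
lemma subnormalCount_ge {δ : ℝ} (hδ : 0 ≤ δ)
    (h : ∀ H : Subgroup G, H.FiniteIndex →
      (p : ℝ) ^ (1 + H.index * δ) ≤ Nat.card (H →* Multiplicative (ZMod p))) (n : ℕ) :
    (p : ℝ) ^ (δ * (((p : ℝ) ^ n - 1) / (p - 1)) - (n : ℝ) ^ 2) ≤ subnormalCount G (p ^ n) := by
  have hp : p.Prime := Fact.out
  have hp1 : (1 : ℝ) < p := by exact_mod_cast hp.one_lt
  have hp2 : (2 : ℝ) ≤ p := by exact_mod_cast hp.two_le
  have hp0 : (0 : ℝ) < p := by linarith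
  induction n with
  | zero => simp [subnormalCount_one]
  | succ n ih =>
    have hstep := subnormalCount_mul_le (p := p) G n ((p : ℝ) ^ ((p : ℝ) ^ n * δ)) ?_
    · have hpos : (0 : ℝ) < (p : ℝ) ^ (n + 1) := pow_pos hp0 _
      refine le_of_mul_le_mul_right (le_trans ?_ hstep) hpos
      refine le_trans ?_ (mul_le_mul_of_nonneg_right ih (Real.rpow_nonneg hp0.le _))
      rw [← Real.rpow_natCast (p : ℝ) (n + 1), ← Real.rpow_add hp0, ← Real.rpow_add hp0]
      refine Real.rpow_le_rpow_of_exponent_le hp1.le ?_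
      have hne : (p : ℝ) - 1 ≠ 0 := by linarith
      have e : δ * (((p : ℝ) ^ (n + 1) - 1) / (p - 1)) =
          δ * (((p : ℝ) ^ n - 1) / (p - 1)) + (p : ℝ) ^ n * δ := by
        field_simp
        ring
      rw [Real.rpow_natCast, e]
      push_cast
      nlinarith [Nat.cast_nonneg (α := ℝ) n]
    · intro H _ hH
      have hfi : H.FiniteIndex := ⟨by rw [hH]; exact (pow_pos hp.pos n).ne'⟩
      refine le_trans ?_ (h H hfi)
      rw [hH, Real.rpow_add hp0, Real.rpow_one]
      push_cast
      have : (1 : ℝ) ≤ (p : ℝ) ^ ((p : ℝ) ^ n * δ) := Real.one_le_rpow hp1.le (by positivity)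
      nlinarith

lemma rpow_le_card_hom_of_pDeficiency {δ : ℝ} (hδ : (δ : EReal) ≤ pDeficiency p G)
    (H : Subgroup G) [H.FiniteIndex] :
    (p : ℝ) ^ (1 + H.index * δ) ≤ Nat.card (H →* Multiplicative (ZMod p)) := by
  have hp1 : (1 : ℝ) < p := by exact_mod_cast (Fact.out : p.Prime).one_lt
  have hn : (0 : ℝ) < H.index := by
    exact_mod_cast Nat.pos_of_ne_zero Subgroup.FiniteIndex.index_ne_zero
  have hc : (1 : ℝ) ≤ Nat.card (H →* Multiplicative (ZMod p)) := by
    exact_mod_cast one_le_card_hom (p := p) H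
  have h := EReal.coe_le_coe_iff.1 (hδ.trans (pDeficiency_le (p := p) H))
  rw [le_div_iff₀ hn] at h
  rw [← Real.le_logb_iff_rpow_le hp1 (by linarith)]
  linarith

/-- The bound of `subnormalCount_ge` with the lower order terms absorbed into a constant. -/
lemma exists_mul_le_subnormalCount {δ ε : ℝ} (hδ : 0 ≤ δ) (hδ' : (δ : EReal) ≤ pDeficiency p G)
    (hε : 0 < ε) :
    ∃ c : ℝ, 0 < c ∧ ∀ n : ℕ, c * (p : ℝ) ^ ((δ - ε) * ((p : ℝ) ^ n / ((p : ℝ) - 1))) ≤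
      subnormalCount G (p ^ n) := by
  have hp : p.Prime := Fact.out
  have hp1 : (1 : ℝ) < p := by exact_mod_cast hp.one_lt
  have hp0 : (0 : ℝ) < p := by linarith
  have hp' : (0 : ℝ) < p - 1 := by linarith
  obtain ⟨C, hC⟩ := exists_sq_le_mul_pow hp.one_lt (div_pos hε hp')
  refine ⟨(p : ℝ) ^ (-(C + δ / (p - 1))), Real.rpow_pos_of_pos hp0 _, fun n => ?_⟩
  refine le_trans ?_ (subnormalCount_ge hδ (fun H _ => rpow_le_card_hom_of_pDeficiency hδ' H) n)
  rw [← Real.rpow_add hp0]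
  refine Real.rpow_le_rpow_of_exponent_le hp1.le ?_
  have h := hC n
  have e : δ * (((p : ℝ) ^ n - 1) / (p - 1)) = δ * ((p : ℝ) ^ n / (p - 1)) - δ / (p - 1) := by ring
  have e' : ε / (p - 1) * (p : ℝ) ^ n = ε * ((p : ℝ) ^ n / (p - 1)) := by ring
  rw [e]
  rw [e'] at h
  linarith

end Growth

lemma pDeficiency_ne_top {p : ℕ} [Fact p.Prime] (G : Type*) [Group G] : pDeficiency p G ≠ ⊤ :=
  ne_top_of_le_ne_top (EReal.coe_ne_top _) (pDeficiency_le (⊤ : Subgroup G))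

/-! ### The pro-`p` completion -/

section Completion

variable {p : ℕ} {G : Type*} [Group G]

/-- The whole group, as a normal subgroup of index `p ^ 0`. -/
def PPowerIndexNormal.top (p : ℕ) (G : Type*) [Group G] : PPowerIndexNormal p G :=
  ⟨⊤, inferInstance, 0, by simp⟩

/-- The projection of the pro-`p` completion to a finite quotient. -/
def completionProj (M : PPowerIndexNormal p G) : proPCompletion p G →* M.Quot :=
  (Pi.evalMonoidHom (fun M : PPowerIndexNormal p G => M.Quot) M).comp (proPCompletion p G).subtype

lemma continuous_completionProj (M : PPowerIndexNormal p G) : Continuous (completionProj M) :=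
  (continuous_apply M).comp continuous_subtype_val

lemma completionProj_eq_of_le {M M' : PPowerIndexNormal p G} (h : M.N ≤ M'.N)
    {x y : proPCompletion p G} (hxy : completionProj M x = completionProj M y) :
    completionProj M' x = completionProj M' y := by
  have hx := x.2 M M' h
  have hy := y.2 M M' h
  change x.1 M' = y.1 M'
  rw [← hx, ← hy]
  exact congrArg _ hxy

/-- The canonical map of a group to its pro-`p` completion. -/
def toCompletion (p : ℕ) (G : Type*) [Group G] : G →* proPCompletion p G where
  toFun g := ⟨fun M => QuotientGroup.mk' M.N g, fun _ _ _ => rfl⟩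
  map_one' := rfl
  map_mul' _ _ := rfl

lemma completionProj_toCompletion_eq_one (M : PPowerIndexNormal p G) (g : G) :
    completionProj M (toCompletion p G g) = 1 ↔ g ∈ M.N :=
  QuotientGroup.eq_one_iff g

lemma exists_completionProj_eq (M : PPowerIndexNormal p G) (x : proPCompletion p G) :
    ∃ g, completionProj M (toCompletion p G g) = completionProj M x :=
  QuotientGroup.mk'_surjective M.N (completionProj M x)

instance isTopologicalGroup_quot (M : PPowerIndexNormal p G) : IsTopologicalGroup M.Quot where
  continuous_mul := continuous_of_discreteTopology
  continuous_inv := continuous_of_discreteTopology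

lemma isClosed_proPCompletion :
    IsClosed (proPCompletion p G : Set (∀ M : PPowerIndexNormal p G, M.Quot)) := by
  have : (proPCompletion p G : Set (∀ M : PPowerIndexNormal p G, M.Quot)) =
      ⋂ (M : PPowerIndexNormal p G) (M' : PPowerIndexNormal p G) (h : M.N ≤ M'.N),
        {x | M.transition M' h (x M) = x M'} := by
    ext x
    simp only [Set.mem_iInter]
    rfl
  rw [this]
  exact isClosed_iInter fun M => isClosed_iInter fun M' => isClosed_iInter fun h =>
    isClosed_eq (continuous_of_discreteTopology.comp (continuous_apply M)) (continuous_apply M')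

lemma index_ker_completionProj (M : PPowerIndexNormal p G) :
    (completionProj M).ker.index = M.N.index := by
  have hs : Function.Surjective (completionProj M) := fun q => by
    obtain ⟨g, hg⟩ := QuotientGroup.mk'_surjective M.N q
    exact ⟨toCompletion p G g, hg⟩
  rw [Subgroup.index_ker, MonoidHom.range_eq_top.2 hs, Subgroup.card_top]
  rfl

variable [Fact p.Prime]

lemma PPowerIndexNormal.finiteIndex (M : PPowerIndexNormal p G) : M.N.FiniteIndex := by
  obtain ⟨k, hk⟩ := M.index_eq
  exact ⟨by rw [hk]; exact (pow_pos (Fact.out : p.Prime).pos k).ne'⟩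

instance PPowerIndexNormal.finite_quot (M : PPowerIndexNormal p G) : Finite M.Quot := by
  have := M.finiteIndex
  exact inferInstanceAs (Finite (G ⧸ M.N))

lemma PPowerIndexNormal.exists_le_inf (M M' : PPowerIndexNormal p G) :
    ∃ L : PPowerIndexNormal p G, L.N ≤ M.N ∧ L.N ≤ M'.N := by
  obtain ⟨k, hk⟩ := M.index_eq
  obtain ⟨l, hl⟩ := M'.index_eq
  refine ⟨⟨M.N ⊓ M'.N, inferInstance, ?_⟩, inf_le_left, inf_le_right⟩
  obtain ⟨j, -, hj⟩ := (Nat.dvd_prime_pow (Fact.out : p.Prime)).1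
    (hk ▸ Subgroup.relIndex_dvd_index_of_normal M.N M'.N)
  refine ⟨j + l, ?_⟩
  rw [pow_add, ← hj, ← hl, ← Subgroup.inf_relIndex_right, Subgroup.relIndex_mul_index inf_le_right]

lemma PPowerIndexNormal.exists_le_finset (s : Finset (PPowerIndexNormal p G)) :
    ∃ L : PPowerIndexNormal p G, ∀ M ∈ s, L.N ≤ M.N := by
  classical
  induction s using Finset.induction_on with
  | empty => exact ⟨PPowerIndexNormal.top p G, by simp⟩
  | insert M s _ ih =>
    obtain ⟨L, hL⟩ := ih
    obtain ⟨L', h1, h2⟩ := M.exists_le_inf L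
    refine ⟨L', fun M' hM' => ?_⟩
    rcases Finset.mem_insert.1 hM' with rfl | h
    · exact h1
    · exact h2.trans (hL M' h)

/-- The fibres of the projections to the finite quotients form a basis of the topology. -/
lemma exists_fibre_subset {U : Set (proPCompletion p G)} (hU : IsOpen U) {x : proPCompletion p G}
    (hx : x ∈ U) :
    ∃ M : PPowerIndexNormal p G, ∀ y, completionProj M y = completionProj M x → y ∈ U := by
  obtain ⟨V, hV, rfl⟩ := isOpen_induced_iff.1 hU
  obtain ⟨s, u, hu, hsu⟩ := isOpen_pi_iff.1 hV x.1 hx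
  obtain ⟨M, hM⟩ := PPowerIndexNormal.exists_le_finset s
  refine ⟨M, fun y hy => hsu fun M' hM' => ?_⟩
  have : y.1 M' = x.1 M' := completionProj_eq_of_le (hM M' hM') hy
  rw [this]
  exact (hu M' hM').2

lemma denseRange_toCompletion : DenseRange (toCompletion p G) := by
  rw [DenseRange, dense_iff_inter_open]
  rintro U hU ⟨x, hx⟩
  obtain ⟨M, hM⟩ := exists_fibre_subset hU hx
  obtain ⟨g, hg⟩ := exists_completionProj_eq M x
  exact ⟨_, hM _ hg, g, rfl⟩

lemma isProP_proPCompletion : IsProP p (proPCompletion p G) where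
  isTopologicalGroup := inferInstance
  compactSpace := isCompact_iff_compactSpace.1 isClosed_proPCompletion.isCompact
  t2Space := inferInstance
  totallyDisconnectedSpace := inferInstance
  index_eq := by
    intro U _ hUo
    obtain ⟨M, hM⟩ := exists_fibre_subset hUo U.one_mem
    obtain ⟨k, hk⟩ := M.index_eq
    have hle : (completionProj M).ker ≤ U := fun y hy => hM y (by rw [map_one]; exact hy)
    have hdvd := Subgroup.index_dvd_of_le hle
    rw [index_ker_completionProj, hk] at hdvd
    obtain ⟨j, -, hj⟩ := (Nat.dvd_prime_pow (Fact.out : p.Prime)).1 hdvd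
    exact ⟨j, hj⟩

/-- The subgroups that are open in the pro-`p` topology: those containing a normal subgroup of
`p`-power index. -/
def IsPOpen (p : ℕ) {G : Type*} [Group G] (K : Subgroup G) : Prop :=
  ∃ M : PPowerIndexNormal p G, M.N ≤ K

lemma index_comap_toCompletion {U : Subgroup (proPCompletion p G)}
    (hU : IsOpen (U : Set (proPCompletion p G))) :
    (U.comap (toCompletion p G)).index = U.index := by
  refine Nat.card_congr (Equiv.ofBijective (Quotient.map' (toCompletion p G) ?_) ⟨?_, ?_⟩)
  · intro a b hab
    rw [QuotientGroup.leftRel_apply] at hab ⊢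
    simpa using hab
  · intro a b
    induction a using QuotientGroup.induction_on with | H a => ?_
    induction b using QuotientGroup.induction_on with | H b => ?_
    intro h
    have h' : ((toCompletion p G a : proPCompletion p G) : proPCompletion p G ⧸ U) =
      (toCompletion p G b : proPCompletion p G) := h
    rw [QuotientGroup.eq] at h'
    rw [QuotientGroup.eq, Subgroup.mem_comap]
    simpa using h'
  · intro x
    induction x using QuotientGroup.induction_on with | H x => ?_
    obtain ⟨M, hM⟩ := exists_fibre_subset hU U.one_mem
    obtain ⟨g, hg⟩ := exists_completionProj_eq M x
    refine ⟨(g : G ⧸ _), ?_⟩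
    change ((toCompletion p G g : proPCompletion p G) : proPCompletion p G ⧸ U) = x
    rw [QuotientGroup.eq]
    refine hM _ ?_
    rw [map_mul, map_inv, hg, inv_mul_cancel, map_one]

/-- Open subgroups of the pro-`p` completion correspond to the subgroups that are open in the
pro-`p` topology. -/
lemma openSubgroupCount_proPCompletion (k : ℕ) :
    openSubgroupCount (proPCompletion p G) k =
      {K : Subgroup G | IsPOpen p K ∧ K.index = k}.ncard := by
  refine Set.BijOn.ncard_eq (f := fun U => U.comap (toCompletion p G)) ⟨?_, ?_, ?_⟩
  · rintro U ⟨hU, rfl⟩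
    obtain ⟨M, hM⟩ := exists_fibre_subset hU U.one_mem
    refine ⟨⟨M, fun g hg => hM _ ?_⟩, index_comap_toCompletion hU⟩
    rw [map_one, completionProj_toCompletion_eq_one]
    exact hg
  · have key : ∀ U V : Subgroup (proPCompletion p G), IsOpen (U : Set (proPCompletion p G)) →
        IsOpen (V : Set (proPCompletion p G)) →
        U.comap (toCompletion p G) ≤ V.comap (toCompletion p G) → U ≤ V := by
      intro U V hU hV h x hx
      obtain ⟨M, hM⟩ := exists_fibre_subset (hU.inter hV) ⟨U.one_mem, V.one_mem⟩
      obtain ⟨g, hg⟩ := exists_completionProj_eq M x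
      have h1 := hM ((toCompletion p G g)⁻¹ * x)
        (by rw [map_mul, map_inv, hg, inv_mul_cancel, map_one])
      have h2 : toCompletion p G g ∈ U := by
        have := U.mul_mem hx (U.inv_mem h1.1)
        simpa using this
      have := V.mul_mem (h h2) h1.2
      simpa using this
    rintro U ⟨hU, -⟩ V ⟨hV, -⟩ h
    exact le_antisymm (key U V hU hV (le_of_eq h)) (key V U hV hU (ge_of_eq h))
  · rintro K ⟨⟨M, hM⟩, rfl⟩
    let U : Subgroup (proPCompletion p G) :=
      (show Subgroup M.Quot from K.map (QuotientGroup.mk' M.N)).comap (completionProj M)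
    have hU : IsOpen (U : Set (proPCompletion p G)) :=
      (isOpen_discrete {q : M.Quot | (show G ⧸ M.N from q) ∈
        K.map (QuotientGroup.mk' M.N)}).preimage (continuous_completionProj M)
    have hc : U.comap (toCompletion p G) = K := by
      change (K.map (QuotientGroup.mk' M.N)).comap (QuotientGroup.mk' M.N) = K
      rw [Subgroup.comap_map_eq, QuotientGroup.ker_mk', sup_eq_left.2 hM]
    refine ⟨U, ⟨hU, ?_⟩, hc⟩
    rw [← index_comap_toCompletion hU, hc]

/-! ### Topological generators of the pro-`p` completion -/

/-- The kernel of a homomorphism to `ZMod p`. -/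
def kerPPower (φ : G →* Multiplicative (ZMod p)) : PPowerIndexNormal p G where
  N := φ.ker
  normal := inferInstance
  index_eq := by
    have h := Subgroup.card_subgroup_dvd_card φ.range
    rw [← Subgroup.index_ker, Nat.card_congr Multiplicative.toAdd, Nat.card_zmod] at h
    rcases (Nat.dvd_prime (Fact.out : p.Prime)).1 h with h | h
    · exact ⟨0, by rw [h, pow_zero]⟩
    · exact ⟨1, by rw [h, pow_one]⟩

/-- The continuous extension of a homomorphism to `ZMod p` to the pro-`p` completion. -/
def completionLift (φ : G →* Multiplicative (ZMod p)) :
    proPCompletion p G →* Multiplicative (ZMod p) :=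
  (show (kerPPower φ).Quot →* Multiplicative (ZMod p) from QuotientGroup.kerLift φ).comp
    (completionProj (kerPPower φ))

lemma isClosed_eqLocus_completionLift (φ ψ : G →* Multiplicative (ZMod p)) :
    IsClosed {x | completionLift φ x = completionLift ψ x} := by
  let e := fun x => (completionProj (kerPPower φ) x, completionProj (kerPPower ψ) x)
  have he : Continuous e :=
    (continuous_completionProj _).prodMk (continuous_completionProj _)
  exact (isClosed_discrete {y : (kerPPower φ).Quot × (kerPPower ψ).Quot |
    QuotientGroup.kerLift φ y.1 = QuotientGroup.kerLift ψ y.2}).preimage he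

/-- Homomorphisms to `ZMod p` are determined by the values of their extensions on topological
generators of the pro-`p` completion. -/
lemma card_hom_le_of_dense {S : Finset (proPCompletion p G)}
    (hS : Dense (Subgroup.closure (S : Set (proPCompletion p G)) : Set (proPCompletion p G))) :
    Nat.card (G →* Multiplicative (ZMod p)) ≤ p ^ S.card := by
  have hinj : Function.Injective
      (fun (φ : G →* Multiplicative (ZMod p)) (s : S) => completionLift φ s) := by
    intro φ ψ h
    have hle : Subgroup.closure (S : Set (proPCompletion p G)) ≤
        (completionLift φ).eqLocus (completionLift ψ) := by
      rw [Subgroup.closure_le]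
      exact fun s hs => congrFun h ⟨s, hs⟩
    have huniv := (isClosed_eqLocus_completionLift φ ψ).closure_subset_iff.2 hle
    ext g
    have := huniv (hS (toCompletion p G g))
    exact this
  have := Nat.card_le_card_of_injective _ hinj
  rw [Nat.card_fun] at this
  simpa using this

lemma dense_of_eq_range_toCompletion {A : Subgroup (proPCompletion p G)}
    (hA : A = (toCompletion p G).range) : Dense (A : Set (proPCompletion p G)) := by
  rw [hA, MonoidHom.coe_range]
  exact denseRange_toCompletion

/-- If `G` has `d` generators and the elementary abelian quotient of rank `d`, then its pro-`p`
completion has topological rank `d`. -/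
lemma topologicalRank_proPCompletion [Group.FG G] {d : ℕ} (hd : Group.rank G = d)
    (hG : p ^ d ≤ Nat.card (G →* Multiplicative (ZMod p))) :
    topologicalRank (proPCompletion p G) = d := by
  classical
  refine le_antisymm ?_ (le_iInf₂ fun S hS => ?_)
  · obtain ⟨S, hS, hgen⟩ := Group.rank_spec G
    refine (iInf₂_le (S.image (toCompletion p G)) (dense_of_eq_range_toCompletion ?_)).trans ?_
    · rw [Finset.coe_image, ← MonoidHom.map_closure, hgen, MonoidHom.range_eq_map]
    · rw [← hd, ← hS]
      exact_mod_cast Finset.card_image_le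
  · have := hG.trans (card_hom_le_of_dense hS)
    exact_mod_cast (Nat.pow_le_pow_iff_right (Fact.out : p.Prime).one_lt).1 this

lemma rank_range_toCompletion [Group.FG G] [Group.FG (toCompletion p G).range] {d : ℕ}
    (hd : Group.rank G = d) (hG : p ^ d ≤ Nat.card (G →* Multiplicative (ZMod p))) :
    Group.rank (toCompletion p G).range = d := by
  classical
  refine le_antisymm ?_ ?_
  · rw [← hd]
    exact Group.rank_le_of_surjective _ (toCompletion p G).rangeRestrict_surjective
  · obtain ⟨S, hS, hgen⟩ := Group.rank_spec (toCompletion p G).range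
    have h := card_hom_le_of_dense (S := S.image (toCompletion p G).range.subtype)
      (dense_of_eq_range_toCompletion (by
        rw [Finset.coe_image, ← MonoidHom.map_closure, hgen, ← MonoidHom.range_eq_map,
          Subgroup.range_subtype]))
    have := (Nat.pow_le_pow_iff_right (Fact.out : p.Prime).one_lt).1 (hG.trans h)
    rw [← hS]
    exact this.trans Finset.card_image_le

/-- In a `p`-group all subgroups of finite index are open in the pro-`p` topology. -/
lemma IsPGroup.isPOpen (hG : IsPGroup p G) (K : Subgroup G) [K.FiniteIndex] : IsPOpen p K :=
  ⟨⟨K.normalCore, inferInstance, hG.index _⟩, K.normalCore_le⟩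

lemma subnormalCount_le_openSubgroupCount [Group.FG G] (hG : IsPGroup p G) (n : ℕ) :
    subnormalCount G (p ^ n) ≤ openSubgroupCount (proPCompletion p G) (p ^ n) := by
  have hne : p ^ n ≠ 0 := (pow_pos (Fact.out : p.Prime).pos n).ne'
  rw [openSubgroupCount_proPCompletion]
  refine Set.ncard_le_ncard (fun K hK => ⟨?_, hK.2⟩)
    ((finite_setOf_index_eq G hne).subset fun K hK => hK.2)
  have : K.FiniteIndex := ⟨by rw [hK.2]; exact hne⟩
  exact hG.isPOpen K

end Completion

/-! ### Upper bound for the free pro-`p` group -/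

/-- In a finite `p`-group every proper subgroup is normal of index `p` in a larger one; hence a
subgroup open in the pro-`p` topology is the kernel of a homomorphism to `ZMod p`. -/
lemma exists_ambientKer_eq {p : ℕ} [Fact p.Prime] {G : Type*} [Group G] {K : Subgroup G}
    (hK : IsPOpen p K) {n : ℕ} (hn : K.index = p ^ (n + 1)) :
    ∃ H : Subgroup G, (IsPOpen p H ∧ H.index = p ^ n) ∧
      ∃ φ : H →* Multiplicative (ZMod p), ambientKer φ = K := by
  have hp : p.Prime := Fact.out
  obtain ⟨M, hM⟩ := hK
  obtain ⟨a, ha⟩ := M.index_eq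
  have hfin : M.N.FiniteIndex := M.finiteIndex
  let f := QuotientGroup.mk' M.N
  have hf : Function.Surjective f := QuotientGroup.mk'_surjective M.N
  let L := K.map f
  have hLK : L.comap f = K := by
    rw [Subgroup.comap_map_eq, QuotientGroup.ker_mk', sup_eq_left.2 hM]
  have hLi : L.index = p ^ (n + 1) := by
    rw [← hn, ← hLK, Subgroup.index_comap_of_surjective _ hf]
  have hcard : Nat.card L * p ^ (n + 1) = p ^ a := by
    rw [← hLi, Subgroup.card_mul_index, ← ha]
    rfl
  obtain ⟨j, -, hj⟩ := (Nat.dvd_prime_pow hp).1 (Dvd.intro _ hcard)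
  have hja : p ^ (j + (n + 1)) = p ^ a := by rw [pow_add, ← hj, hcard]
  have hQ : Nat.card (G ⧸ M.N) = p ^ (j + 1) * p ^ n := by
    rw [← pow_add, show j + 1 + n = j + (n + 1) by ring, hja, ← ha]
    rfl
  obtain ⟨E, hE, hLE⟩ := Sylow.exists_subgroup_card_pow_succ (hQ ▸ Dvd.intro _ rfl) hj
  have hEi : E.index = p ^ n := by
    have := E.card_mul_index
    rw [hE, hQ] at this
    exact Nat.eq_of_mul_eq_mul_left (pow_pos hp.pos _) this
  have hLEi : (L.subgroupOf E).index = p := by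
    have := Subgroup.relIndex_mul_index hLE
    rw [hLi, hEi, pow_succ'] at this
    exact Nat.eq_of_mul_eq_mul_right (pow_pos hp.pos _) this
  have hnormal : (L.subgroupOf E).Normal :=
    Subgroup.normal_of_index_eq_minFac_card (by rw [hLEi, hE, hp.pow_minFac (by omega)])
  let e : (E ⧸ L.subgroupOf E) ≃* Multiplicative (ZMod p) :=
    mulEquivOfPrimeCardEq (p := p) hLEi (by simp)
  have hMker : M.N ≤ E.comap f := fun g hg => by
    rw [Subgroup.mem_comap, show f g = 1 from (QuotientGroup.eq_one_iff g).2 hg]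
    exact E.one_mem
  refine ⟨E.comap f, ⟨⟨M, hMker⟩, by rw [Subgroup.index_comap_of_surjective _ hf, hEi]⟩,
    e.toMonoidHom.comp ((QuotientGroup.mk' (L.subgroupOf E)).comp (f.subgroupComap E)), ?_⟩
  have key : ∀ g : E.comap f, (g : G) ∈ K ↔
      (e.toMonoidHom.comp
        ((QuotientGroup.mk' (L.subgroupOf E)).comp (f.subgroupComap E))) g = 1 := by
    intro g
    rw [MonoidHom.comp_apply, MulEquiv.toMonoidHom_eq_coe, MonoidHom.coe_coe,
      EmbeddingLike.map_eq_one_iff, MonoidHom.comp_apply, QuotientGroup.mk'_apply,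
      QuotientGroup.eq_one_iff, Subgroup.mem_subgroupOf, ← hLK]
    rfl
  refine le_antisymm (fun g hg => ?_) fun g hg => ?_
  · exact (key ⟨g, ambientKer_le hg⟩).2 ((mem_ambientKer ⟨g, ambientKer_le hg⟩).1 hg)
  · have hgE : g ∈ E.comap f := hLE (by rw [← hLK] at hg; exact hg)
    exact (mem_ambientKer ⟨g, hgE⟩).2 ((key ⟨g, hgE⟩).1 hg)

/-- The subgroups of index `p ^ n` that are open in the pro-`p` topology of a free group of rank `d`
number at most `p ^ (n + (d - 1) (p ^ n - 1) / (p - 1))`. -/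
lemma ncard_isPOpen_le {p : ℕ} [Fact p.Prime] {d : ℕ} (hd : 1 ≤ d) (n : ℕ) :
    ({K : Subgroup (FreeGroup (Fin d)) | IsPOpen p K ∧ K.index = p ^ n}.ncard : ℝ) ≤
      (p : ℝ) ^ (n + (d - 1) * (((p : ℝ) ^ n - 1) / (p - 1)) : ℝ) := by
  classical
  have hp : p.Prime := Fact.out
  have hp1 : (1 : ℝ) < p := by exact_mod_cast hp.one_lt
  have hp0 : (0 : ℝ) < p := by linarith
  let T : ℕ → Set (Subgroup (FreeGroup (Fin d))) := fun n => {K | IsPOpen p K ∧ K.index = p ^ n}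
  change ((T n).ncard : ℝ) ≤ _
  have hT : ∀ n, (T n).Finite := fun n =>
    (finite_setOf_index_eq _ (pow_pos hp.pos n).ne').subset fun H hH => hH.2
  have := fun n => (hT n).fintype
  have hfi : ∀ n, ∀ H : T n, H.1.FiniteIndex := fun n H =>
    ⟨by rw [H.2.2]; exact (pow_pos hp.pos n).ne'⟩
  have hfin : ∀ n, ∀ H : T n, Finite (H.1 →* Multiplicative (ZMod p)) := fun n H =>
    finite_monoidHom _ _
  induction n with
  | zero =>
    have : (T 0).ncard ≤ 1 := by
      rw [Set.ncard_le_one_iff (hT 0)]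
      intro H K hH hK
      rw [Subgroup.index_eq_one.1 (hH.2.trans (pow_zero p)),
        Subgroup.index_eq_one.1 (hK.2.trans (pow_zero p))]
    simpa using this
  | succ n ih =>
    choose H hH φ hφ using fun K : T (n + 1) => exists_ambientKer_eq K.2.1 K.2.2
    let f : T (n + 1) → Σ H : T n, (H.1 →* Multiplicative (ZMod p)) := fun K => ⟨⟨H K, hH K⟩, φ K⟩
    have hf : Function.Injective f := by
      intro K L h
      have := congrArg (fun u : Σ H : T n, (H.1 →* Multiplicative (ZMod p)) => ambientKer u.2) h
      exact Subtype.ext (by rw [← hφ K, ← hφ L]; exact this)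
    have hcard := Nat.card_le_card_of_injective f hf
    rw [Nat.card_sigma, Finset.sum_congr rfl fun H _ => by
      rw [card_hom_subgroup_freeGroup hd H.1, H.2.2], Finset.sum_const, Finset.card_univ,
      ← Nat.card_eq_fintype_card, smul_eq_mul] at hcard
    change (T (n + 1)).ncard ≤ (T n).ncard * _ at hcard
    have hcard' : ((T (n + 1)).ncard : ℝ) ≤
        (T n).ncard * (p : ℝ) ^ (1 + (d - 1) * (p : ℝ) ^ n) := by
      have e : (1 + (d - 1) * (p : ℝ) ^ n : ℝ) = ((1 + (d - 1) * p ^ n : ℕ) : ℝ) := by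
        push_cast [Nat.cast_sub hd]
        ring
      rw [e, Real.rpow_natCast]
      exact_mod_cast hcard
    refine hcard'.trans ((mul_le_mul_of_nonneg_right ih (Real.rpow_nonneg hp0.le _)).trans ?_)
    rw [← Real.rpow_add hp0]
    refine Real.rpow_le_rpow_of_exponent_le hp1.le (le_of_eq ?_)
    have hne : (p : ℝ) - 1 ≠ 0 := by linarith
    push_cast
    field_simp
    ring

/-- The comparison of the subgroup growth of the free pro-`p` group with that of the pro-`p`
completion of a `p`-group with `p`-deficiency close to `d - 1`. -/
lemma exists_mul_rpow_le_openSubgroupCount {p : ℕ} [Fact p.Prime] {d : ℕ} (hd : 2 ≤ d) {ε : ℝ}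
    (hε : 0 < ε) (hε2 : ε ≤ 1 / 2) {G : Type*} [Group G] [Group.FG G] (hG : IsPGroup p G)
    (hdef : (((d : ℝ) - 1 - ε / 4 : ℝ) : EReal) ≤ pDeficiency p G) {ε' : ℝ} (hεε' : ε ≤ ε') :
    ∃ c : ℝ, 0 < c ∧ ∀ n : ℕ,
      c * (openSubgroupCount (FreeProP p d) (p ^ n) : ℝ) ^ (1 - ε') ≤
        (openSubgroupCount (proPCompletion p G) (p ^ n) : ℝ) := by
  have hp : p.Prime := Fact.out
  have hp1 : (1 : ℝ) < p := by exact_mod_cast hp.one_lt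
  have hp0 : (0 : ℝ) < p := by linarith
  have hp' : (0 : ℝ) < p - 1 := by linarith
  have hd' : (2 : ℝ) ≤ d := by exact_mod_cast hd
  obtain ⟨c, hc, hcn⟩ := exists_mul_le_subnormalCount (ε := ε / 4) (by linarith) hdef (by linarith)
  obtain ⟨C, hC⟩ := exists_sq_le_mul_pow hp.one_lt (div_pos (half_pos hε) hp')
  refine ⟨c * (p : ℝ) ^ (-C), mul_pos hc (Real.rpow_pos_of_pos hp0 _), fun n => ?_⟩
  have hupper := ncard_isPOpen_le (p := p) (d := d) (by omega) n
  rw [← openSubgroupCount_proPCompletion] at hupper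
  set s := openSubgroupCount (FreeProP p d) (p ^ n)
  set y : ℝ := (p : ℝ) ^ n / (p - 1) with hy
  have hy0 : 0 < y := div_pos (pow_pos hp0 n) hp'
  have hB : (s : ℝ) ≤ (p : ℝ) ^ (n + (d - 1) * y : ℝ) := by
    refine hupper.trans (Real.rpow_le_rpow_of_exponent_le hp1.le ?_)
    have : ((p : ℝ) ^ n - 1) / (p - 1) ≤ y := by
      rw [hy]
      gcongr
      linarith
    have := mul_le_mul_of_nonneg_left this (by linarith : (0 : ℝ) ≤ d - 1)
    linarith
  have hB1 : (1 : ℝ) ≤ (p : ℝ) ^ (n + (d - 1) * y : ℝ) := by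
    refine Real.one_le_rpow hp1.le ?_
    have := mul_nonneg (by linarith : (0 : ℝ) ≤ d - 1) hy0.le
    positivity
  have hpow : (s : ℝ) ^ (1 - ε') ≤ ((p : ℝ) ^ (n + (d - 1) * y : ℝ)) ^ (1 - ε) := by
    -- The exponent `1 - ε'` may be zero or negative, so that `s = 0` is treated apart and `ε'` is
    -- replaced by `ε ≤ 1 / 2` using `1 ≤ s`.
    rcases Nat.eq_zero_or_pos s with h0 | h0
    · rw [h0, Nat.cast_zero]
      exact (Real.zero_rpow_le_one _).trans (Real.one_le_rpow hB1 (by linarith))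
    · have h1 : (1 : ℝ) ≤ s := by exact_mod_cast h0
      exact (Real.rpow_le_rpow_of_exponent_le h1 (by linarith)).trans
        (Real.rpow_le_rpow (by linarith) hB (by linarith))
  have hlow : (c * (p : ℝ) ^ ((d - 1 - ε / 4 - ε / 4) * y) : ℝ) ≤
      openSubgroupCount (proPCompletion p G) (p ^ n) :=
    (hcn n).trans (by exact_mod_cast subnormalCount_le_openSubgroupCount hG n)
  refine le_trans ?_ hlow
  -- The exponents compare because `(1 - ε) (d - 1) ≤ d - 1 - ε`, where `ε / 2` is the loss in the
  -- lower bound, and the other `ε / 2` and the constant `C` absorb the term `n`.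
  rw [mul_assoc]
  refine mul_le_mul_of_nonneg_left ?_ hc.le
  refine (mul_le_mul_of_nonneg_left hpow (Real.rpow_nonneg hp0.le _)).trans ?_
  rw [← Real.rpow_mul hp0.le, ← Real.rpow_add hp0]
  refine Real.rpow_le_rpow_of_exponent_le hp1.le ?_
  have h1 := hC n
  have h2 : ε / 2 / (p - 1) * (p : ℝ) ^ n = ε / 2 * y := by rw [hy]; ring
  have h3 : (n : ℝ) ≤ (n : ℝ) ^ 2 := by exact_mod_cast Nat.le_self_pow two_ne_zero n
  have h4 : (0 : ℝ) ≤ ε * n := by positivity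
  have h5 : ε * y ≤ ε * ((d - 1) * y) := by
    refine mul_le_mul_of_nonneg_left ?_ hε.le
    nlinarith
  rw [h2] at h1
  linarith

theorem proposition3 (p : ℕ) (hp : p.Prime) :
    -- (1)
    (∀ (Γ : Type*) [Group Γ] [Group.FG Γ], IsPGroup p Γ → Group.ResiduallyFinite Γ →
      pDeficiency p Γ ≤ (rankGradient Γ : EReal)) ∧
    -- (2)
    (∀ (Γ : Type*) [Group Γ], 0 ≤ pDeficiency p Γ →
      pDeficiency p Γ ≠ ⊤ ∧
      ∀ ε : ℝ, 0 < ε → ∃ c : ℝ, 0 < c ∧ ∀ n : ℕ,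
        c * (p : ℝ) ^ (((pDeficiency p Γ).toReal - ε) * ((p : ℝ) ^ n / ((p : ℝ) - 1))) ≤
          (subnormalCount Γ (p ^ n) : ℝ)) ∧
    -- (3)
    (∀ d : ℕ, 2 ≤ d → ∀ ε : ℝ, 0 < ε →
      ∃ (Γ : Type) (_ : Group Γ) (_ : Group.FG Γ),
        Group.rank Γ = d ∧ IsPGroup p Γ ∧
        (((d : ℝ) - 1 - ε : ℝ) : EReal) ≤ pDeficiency p Γ) ∧
    -- (4)
    (∀ d : ℕ, 2 ≤ d → ∀ ε : ℝ, 0 < ε →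
      ∃ (Γ : Type) (_ : Group Γ) (_ : TopologicalSpace Γ),
        IsProP p Γ ∧ topologicalRank Γ = d ∧
        (∃ (D : Subgroup Γ) (_ : Group.FG D),
          Dense (D : Set Γ) ∧ IsPGroup p D ∧ Group.rank D = d) ∧
        ∃ c : ℝ, 0 < c ∧ ∀ n : ℕ,
          c * (openSubgroupCount (FreeProP p d) (p ^ n) : ℝ) ^ (1 - ε) ≤
            (openSubgroupCount Γ (p ^ n) : ℝ)) := by
  have : Fact p.Prime := ⟨hp⟩
  refine ⟨fun Γ _ _ _ _ => pDeficiency_le_rankGradient Γ, fun Γ _ h0 => ?_, fun d _ ε hε => ?_,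
    fun d hd ε hε => ?_⟩
  · have hbot : pDeficiency p Γ ≠ ⊥ := ne_bot_of_le_ne_bot (by simp) h0
    have := fg_of_pDeficiency_ne_bot hbot
    refine ⟨pDeficiency_ne_top Γ, fun ε hε => ?_⟩
    refine exists_mul_le_subnormalCount (EReal.toReal_nonneg h0) (le_of_eq ?_) hε
    exact EReal.coe_toReal (pDeficiency_ne_top Γ) hbot
  · obtain ⟨Γ, _, _, h1, h2, h3, -⟩ := exists_isPGroup_pDeficiency_ge (p := p) d hε
    exact ⟨Γ, inferInstance, inferInstance, h1, h2, h3⟩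
  · have hε₁ : 0 < min ε (1 / 2) := lt_min hε (by norm_num)
    obtain ⟨G, _, _, h1, h2, h3, h4⟩ :=
      exists_isPGroup_pDeficiency_ge (p := p) d (by linarith : 0 < min ε (1 / 2) / 4)
    have hfg : Group.FG (toCompletion p G).range :=
      Group.fg_of_surjective (toCompletion p G).rangeRestrict_surjective
    exact ⟨proPCompletion p G, inferInstance, inferInstance, isProP_proPCompletion,
      topologicalRank_proPCompletion h1 h4,
      ⟨(toCompletion p G).range, hfg, dense_of_eq_range_toCompletion rfl,
        h2.of_surjective _ (toCompletion p G).rangeRestrict_surjective,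
        rank_range_toCompletion h1 h4⟩,
      exists_mul_rpow_le_openSubgroupCount hd hε₁ (min_le_right _ _) h2 h3 (min_le_left _ _)⟩
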